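/- Let $d\in\mathbb N$ and let $\mu$ be a log-concave probability measure on $\mathbb R^d$ with finite second moment. Assume that it is regular enough for the quantities below to be defined and integrated by parts, namely: $\mu$ has a density $e^{U}$ with $U=\log\mu:\mathbb R^d\to\mathbb R$ smooth (and concave), and $\nabla^kU\in L^p(\mu)$ for all $k\ge 1$ and $p<\infty$. For vector fields $\Phi_1,\dots,\Phi_n$ ($n\ge1$) let $$\Lambda_n(\Phi_1,\dots,\Phi_n)=\frac{(-1)^n}{n}\sum_{\sigma\in\mathfrak S_n}\operatorname{tr}\big(\nabla\Phi_{\sigma(1)}\cdots\nabla\Phi_{\sigma(n)}\big),\qquad (\nabla\Phi)_{i}{}^{j}=\partial_i\Phi^j .$$ The contraction of the symbol $\Lambda^{(n,\mu)}$ with $n$ vector fields is the number $\int\Lambda_n(\Phi_1,\dots,\Phi_n)\,d\mu$; its contraction with $n-1$ vector fields is the smooth vector field $\Psi\in L^2_\mu$ such that $\int \xi^\top\Psi\,d\mu=\int\Lambda_n(\Phi_1,\dots,\Phi_{n-1},\xi)\,d\mu$ for all smooth $\xi\in L^2_\mu$ for which the right-hand integral converges. For a finite tree $G$ with at least two nodes,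 $\mathrm{val}_\mu(G)$ is the number obtained by reading each node with $k$ edges as the symbol $\Lambda^{(k,\mu)}$ and each edge as a contraction. It is evaluated from any chosen node inwards: for each edge $xy$, the branch containing $x$ gives the vector field obtained by contracting the symbol at $x$ with the fields of the branches at its other neighbours, and $\mathrm{val}_\mu(G)$ is the contraction of the symbol at a node with the fields of all its branches. The value of a forest is the sum of the values of its components. The forests $F^n$ are defined by: $F^0$ is a single node, and $F^{n+1}$ consists, for each node $X$ of $F^n$, of a copy of the component of $X$ with a leaf added at $X$. Let $S_1,S_2,S_3$ be the following trees with five nodes: the star; the path with four nodes with an additional leaf attached to one of its two inner nodes; the path. Let $T_1,\dots,T_6$ be the following trees with six nodes: $T_1$ the star; $T_2$ an edge with two leaves attached to each of its ends; $T_3$ the path; $T_4$ the star with four edges with one of these edges subdivided; $T_5$ the path with five nodes with a leaf attached to its middle node; $T_6$ the path with five nodes with a leaf attached to a neighbour of one of its end nodes. Then, up to isomorphism, the components of $F^4$ are exactly $S_1,S_2,S_3$ and those of $F^5$ are exactly $T_1,\dots,T_6$. For each of these trees (and each component of $F^4$ and $F^5$) the value is well defined, i.e. the evaluation exists, is unique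 and does not depend on the chosen node, and $$\mathrm{val}_\mu(S_i)\ge 0\quad(i=1,2,3),\qquad \mathrm{val}_\mu(T_i)\ge0\quad(i=1,\dots,6).$$ In particular $\mathrm{val}_\mu(F^4)\ge0$ and $\mathrm{val}_\mu(F^5)\ge 0$. -/

import Mathlib

open MeasureTheory
open scoped ContDiff ENNReal NNReal

namespace GCM

/-- Euclidean space of dimension `d`. -/
abbrev E (d : ℕ) : Type := EuclideanSpace ℝ (Fin d)

/-- The matrix field `(∇Φ) i j = ∂ᵢ Φ^j` of a vector field `Φ`. -/
noncomputable def gradMatrix {d : ℕ} (Φ : E d → E d) (x : E d) : Matrix (Fin d) (Fin d) ℝ :=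
  Matrix.of fun i j => fderiv ℝ Φ x (EuclideanSpace.single i (1 : ℝ)) j

open Classical in
/-- The operator `Λₙ` for `n ≥ 1` vector fields,
`Λₙ(Φ₁, …, Φₙ) = (-1)ⁿ (1/n) ∑_σ tr (∇Φ_{σ 1} ⋯ ∇Φ_{σ n})`.
As `Λₙ` is symmetric, the fields may be indexed by any type `ι` with `n` elements; the sum is then
over all enumerations of `ι` (for `ι = Fin n`, over all permutations). -/
noncomputable def Lam {d : ℕ} {ι : Type} [Fintype ι] (Φ : ι → E d → E d) (x : E d) : ℝ :=
  (-1) ^ Fintype.card ι * (1 / (Fintype.card ι : ℝ)) *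
    ∑ e : Fin (Fintype.card ι) ≃ ι,
      ((List.ofFn fun k => gradMatrix (Φ (e k)) x).prod).trace

/-- The vector fields in `L²_μ ∩ 𝔛(ℝ^d)`: smooth and square-integrable with respect to `μ`. -/
def IsSmoothL2 {d : ℕ} (μ : Measure (E d)) (Φ : E d → E d) : Prop :=
  ContDiff ℝ ∞ Φ ∧ MemLp Φ 2 μ

open Classical in
/-- `Ψ` is the vector field obtained by contracting the tensor `Λ^{(n,μ)}` with the fields `Φ i`,
`i ≠ j`, the slot `j` being left free: `Ψ` belongs to `L²_μ ∩ 𝔛(ℝ^d)` and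
`∫ ⟨ξ, Ψ⟩ dμ = ∫ Λₙ(Φ with ξ in slot j) dμ` for every `ξ` in `L²_μ ∩ 𝔛(ℝ^d)` for which the right-hand
integral converges. The value of `Φ` at `j` plays no role. -/
def IsContraction {d : ℕ} (μ : Measure (E d)) {ι : Type} [Fintype ι]
    (Φ : ι → E d → E d) (j : ι) (Ψ : E d → E d) : Prop :=
  IsSmoothL2 μ Ψ ∧
    ∀ ξ : E d → E d, IsSmoothL2 μ ξ → Integrable (Lam (Function.update Φ j ξ)) μ →
      ∫ x, inner ℝ (ξ x) (Ψ x) ∂μ = ∫ x, Lam (Function.update Φ j ξ) x ∂μ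

open Classical in
/-- `c` is the scalar associated to the tree `G` (with at least two nodes), in which a node with `k`
edges stands for the symbol `Λ^{(k,μ)}` and edges stand for contractions.

For an edge `x y`, the field `m x y` is the value of the part of the tree on the side of `x`
once this edge is cut, dangling at `x`: the symbol at `x` contracted with the fields
coming from all the neighbours of `x` other than `y`. The scalar is then obtained at any node `x`,
by contracting the symbol at `x` with the fields coming from all its neighbours; it has to be the
same for every node `x`, i.e. for every order in which the products can be evaluated. -/
def IsTreeVal {d : ℕ} (μ : Measure (E d)) {V : Type} [Fintype V] (G : SimpleGraph V) (c : ℝ) :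
    Prop :=
  ∃ m : V → V → E d → E d,
    (∀ (x y : V) (h : G.Adj x y),
      IsContraction μ (fun z : G.neighborSet x => m z x) ⟨y, h⟩ (m x y)) ∧
    ∀ x : V, Integrable (Lam fun z : G.neighborSet x => m z x) μ ∧
      ∫ p, Lam (fun z : G.neighborSet x => m z x) p ∂μ = c

open Classical in
/-- The scalar `val_μ(G)` associated to the tree `G` (the number `c` with `IsTreeVal μ G c`,
with the default `0` if there were none). -/
noncomputable def treeVal {d : ℕ} (μ : Measure (E d)) {V : Type} [Fintype V]
    (G : SimpleGraph V) : ℝ :=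
  if h : ∃ c, IsTreeVal μ G c then h.choose else 0

/-- The tree `T` with one new leaf (the last vertex) attached to the node `x`. -/
def addLeaf {n : ℕ} (T : SimpleGraph (Fin n)) (x : Fin n) : SimpleGraph (Fin (n + 1)) :=
  T.map Fin.castSuccEmb ⊔ SimpleGraph.edge x.castSucc (Fin.last n)

/-- The forest `F^n`, as the list of its tree components: `F^0` is a single node, and `F^{n+1}`
contains, for every component `T` of `F^n` and every node `x` of `T`, the tree `T` with a leaf
added at `x`. -/
def forest : (n : ℕ) → List (SimpleGraph (Fin (n + 1)))
  | 0 => [⊥]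
  | n + 1 => (forest n).flatMap fun T => (List.finRange (n + 1)).map (addLeaf T)

/-- The scalar associated to a forest: the sum of the scalars associated to its components. -/
noncomputable def forestVal {d : ℕ} (μ : Measure (E d)) {V : Type} [Fintype V]
    (F : List (SimpleGraph V)) : ℝ :=
  (F.map (treeVal μ)).sum

/-- The trees `S₁` (star), `S₂` (a path with three edges, one end node of which is doubled),
`S₃` (path). -/
def treeS : Fin 3 → SimpleGraph (Fin 5)
  | 0 => SimpleGraph.fromEdgeSet {s(0, 1), s(0, 2), s(0, 3), s(0, 4)}
  | 1 => SimpleGraph.fromEdgeSet {s(0, 2), s(1, 2), s(2, 3), s(3, 4)}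
  | 2 => SimpleGraph.fromEdgeSet {s(0, 1), s(1, 2), s(2, 3), s(3, 4)}

/-- The trees `T₁, …, T₆`. -/
def treeT : Fin 6 → SimpleGraph (Fin 6)
  | 0 => SimpleGraph.fromEdgeSet {s(0, 1), s(0, 2), s(0, 3), s(0, 4), s(0, 5)}
  | 1 => SimpleGraph.fromEdgeSet {s(0, 1), s(1, 2), s(2, 3), s(1, 4), s(2, 5)}
  | 2 => SimpleGraph.fromEdgeSet {s(0, 1), s(1, 2), s(2, 3), s(3, 4), s(4, 5)}
  | 3 => SimpleGraph.fromEdgeSet {s(0, 1), s(1, 2), s(2, 3), s(1, 4), s(1, 5)}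
  | 4 => SimpleGraph.fromEdgeSet {s(0, 1), s(1, 2), s(2, 3), s(3, 4), s(2, 5)}
  | 5 => SimpleGraph.fromEdgeSet {s(0, 2), s(1, 2), s(2, 3), s(3, 4), s(4, 5)}

end GCM

open GCM

/-! Notation: `K = -∇²U`, positive semidefinite by concavity; `L f = Δf + ∇U·∇f`, acting entrywise
on matrix fields; `T_k = ∂ₖK`; `S = ∑ₖ T_k²`; `M = LK - K²`.

Well-definedness. For the density `e^U`, integration by parts gives every contraction in closed
form, as minus a weighted divergence of the coefficients of `∇ξ` (`isContraction_contr`); full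
support of `μ` makes it unique (`IsContraction.eq_contr`). A leaf gives `∇U`, so every branch field
is a differential polynomial in the derivatives of `U` of order at least one. These are closed under
all operations needed and lie in every `L^p(μ)` with `p < ∞`, so all integrals converge. The values
read at the two ends of an edge are the same `L²` pairing of the two branch fields, and the tree is
connected, so the root does not matter.

Values. If a node has `n + 1` neighbours, all but one with branch field `φ` and the last with `ψ`,
the value is `(-1)^(n+1) n! ∫ tr((∇φ)^n ∇ψ)`. The gradient of a leaf is `-K`; contracting with `Λ₂`
sends a symmetric gradient `A` to `KA - LA`, so paths of two and three nodes have gradients `M` and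
`KM - LM`. With good roots: `S₁ = 6∫tr K⁴`, `S₂ = -2∫tr(K²M)`, `S₃ = ∫tr M²`, `T₁ = 24∫tr K⁵`, `T₄ =
-6∫tr(K³M)`, `T₅ = 2∫tr(KM²)`, `T₆ = -2∫tr(K²(KM - LM))`, while `T₂` and `T₃` are symmetric about an
edge, hence squared `L²` norms.

`S₂` and `T₄` become nonnegative after one integration by parts. `T₆` is the hard case. With `X =
LK`, moving `L` onto `K²` produces `2∫tr(KX²) + 2∫tr(SX)` and terms of known sign. Here `∫tr(SX) =
-2Y` for a mixed term `Y` without a sign, but also `∫tr(KX²) = 3Y + R` with `R ≥ 0`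
(`integral_trace_mul_LM_LM`). Eliminating `Y` leaves `(2/3)∫tr(KX²) + (4/3)R ≥ 0`.

The list of components follows from explicit isomorphisms at each leaf-adding step. -/

namespace GCM

/-! ### Partial derivatives and differential polynomials in the derivatives of `U` -/

variable {d : ℕ}

/-- The partial derivative `∂ᵢ f`. -/
noncomputable def D (i : Fin d) (f : E d → ℝ) (x : E d) : ℝ :=
  fderiv ℝ f x (EuclideanSpace.single i 1)

lemma contDiff_D {f : E d → ℝ} (hf : ContDiff ℝ ∞ f) (i : Fin d) : ContDiff ℝ ∞ (D i f) :=
  (hf.fderiv_right (m := ∞) (by simp)).clm_apply contDiff_const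

lemma D_const (i : Fin d) (c : ℝ) : D i (fun _ => c) = fun _ => 0 := by
  funext x; simp [D]

lemma D_add {f g : E d → ℝ} (hf : ContDiff ℝ ∞ f) (hg : ContDiff ℝ ∞ g) (i : Fin d) :
    D i (fun x => f x + g x) = fun x => D i f x + D i g x := by
  funext x
  simp only [D]
  rw [fderiv_fun_add (hf.differentiable (by simp) x) (hg.differentiable (by simp) x)]
  rfl

lemma D_mul {f g : E d → ℝ} (hf : ContDiff ℝ ∞ f) (hg : ContDiff ℝ ∞ g) (i : Fin d) :
    D i (fun x => f x * g x) = fun x => D i f x * g x + f x * D i g x := by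
  funext x
  simp only [D]
  rw [fderiv_fun_mul (hf.differentiable (by simp) x) (hg.differentiable (by simp) x)]
  simp only [add_apply, smul_apply, smul_eq_mul]
  ring

lemma D_const_mul {f : E d → ℝ} (hf : ContDiff ℝ ∞ f) (c : ℝ) (i : Fin d) :
    D i (fun x => c * f x) = fun x => c * D i f x := by
  rw [D_mul contDiff_const hf]
  simp [D_const]

lemma D_sum {ι : Type*} (s : Finset ι) {f : ι → E d → ℝ} (hf : ∀ a ∈ s, ContDiff ℝ ∞ (f a))
    (i : Fin d) : D i (fun x => ∑ a ∈ s, f a x) = fun x => ∑ a ∈ s, D i (f a) x := by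
  funext x
  simp only [D]
  rw [fderiv_fun_sum fun a ha => (hf a ha).differentiable (by simp) x]
  simp

lemma D_comm {f : E d → ℝ} (hf : ContDiff ℝ ∞ f) (i j : Fin d) :
    D i (D j f) = D j (D i f) := by
  have key : ∀ (i j : Fin d) (x : E d), D i (D j f) x =
      fderiv ℝ (fderiv ℝ f) x (EuclideanSpace.single i 1) (EuclideanSpace.single j 1) := by
    intro i j x
    have hd : DifferentiableAt ℝ (fderiv ℝ f) x :=
      (hf.fderiv_right (m := ∞) (by simp)).differentiable (by simp) x
    show fderiv ℝ (fun y => fderiv ℝ f y (EuclideanSpace.single j 1)) x _ = _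
    rw [fderiv_clm_apply hd (differentiableAt_const _)]
    simp
  funext x
  rw [key, key]
  exact (hf.contDiffAt.isSymmSndFDerivAt (by
    rw [minSmoothness_of_isRCLikeNormedField]
    exact WithTop.coe_le_coe.2 (le_top : (2 : ℕ∞) ≤ ⊤))) _ _

/-- The iterated partial derivatives of `U`. -/
noncomputable def DU (U : E d → ℝ) (w : List (Fin d)) : E d → ℝ := w.foldr D U

lemma contDiff_DU {U : E d → ℝ} (hU : ContDiff ℝ ∞ U) (w : List (Fin d)) :
    ContDiff ℝ ∞ (DU U w) := by
  induction w with
  | nil => exact hU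
  | cons i w ih => exact contDiff_D ih i

lemma DU_eq_iteratedFDeriv {U : E d → ℝ} (hU : ContDiff ℝ ∞ U) (w : List (Fin d)) :
    ∃ v : Fin w.length → E d, (∀ k, ‖v k‖ = 1) ∧
      ∀ x, DU U w x = iteratedFDeriv ℝ w.length U x v := by
  induction w with
  | nil => exact ⟨Fin.elim0, fun k => k.elim0, fun x => rfl⟩
  | cons i w ih =>
    obtain ⟨v, hv, h⟩ := ih
    refine ⟨Fin.cons (EuclideanSpace.single i 1) v, ?_, fun x => ?_⟩
    · intro k
      refine Fin.cases ?_ (fun k => ?_) k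
      · simp
      · simpa using hv k
    · have hfun : DU U w = fun x => iteratedFDeriv ℝ w.length U x v := funext h
      show D i (DU U w) x = iteratedFDeriv ℝ (w.length + 1) U x _
      rw [iteratedFDeriv_succ_apply_left, hfun, D,
        fderiv_continuousMultilinear_apply_const_apply]
      · rfl
      · exact (hU.differentiable_iteratedFDeriv (m := w.length)
          (by exact_mod_cast WithTop.coe_lt_coe.2 (ENat.natCast_lt_top _))) x

/-- The algebra of differential polynomials in the derivatives of `U`. -/
inductive DiffPoly (U : E d → ℝ) : (E d → ℝ) → Prop
  | const (c : ℝ) : DiffPoly U fun _ => c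
  -- The list is nonempty because moments are assumed for the derivatives of `U`, not for `U`
  -- itself.
  | deriv (i : Fin d) (w : List (Fin d)) : DiffPoly U (DU U (i :: w))
  | add {f g : E d → ℝ} : DiffPoly U f → DiffPoly U g → DiffPoly U fun x => f x + g x
  | mul {f g : E d → ℝ} : DiffPoly U f → DiffPoly U g → DiffPoly U fun x => f x * g x

/-- The standing regularity assumptions on `μ` and its log-density `U`. -/
structure Regular (μ : Measure (E d)) (U : E d → ℝ) : Prop where
  smooth : ContDiff ℝ ∞ U
  dens : μ = volume.withDensity fun x => ENNReal.ofReal (Real.exp (U x))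
  mom : ∀ k : ℕ, 1 ≤ k → ∀ p : ℝ≥0, MemLp (iteratedFDeriv ℝ k U) (p : ℝ≥0∞) μ

namespace DiffPoly

variable {U : E d → ℝ} {f g : E d → ℝ}

lemma D_self (i : Fin d) : DiffPoly U (D i U) := deriv i []

lemma neg (hf : DiffPoly U f) : DiffPoly U fun x => -f x := by
  simpa using (const (U := U) (-1)).mul hf

lemma sub (hf : DiffPoly U f) (hg : DiffPoly U g) : DiffPoly U fun x => f x - g x := by
  simpa [sub_eq_add_neg] using hf.add hg.neg

lemma const_mul (hf : DiffPoly U f) (c : ℝ) : DiffPoly U fun x => c * f x := (const c).mul hf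

lemma sum {ι : Type*} (s : Finset ι) {f : ι → E d → ℝ} (hf : ∀ a ∈ s, DiffPoly U (f a)) :
    DiffPoly U fun x => ∑ a ∈ s, f a x := by
  classical
  induction s using Finset.induction_on with
  | empty => simpa using const (U := U) 0
  | insert a s ha ih =>
    simp only [Finset.sum_insert ha]
    exact (hf a (by simp)).add (ih fun b hb => hf b (by simp [hb]))

lemma contDiff (hU : ContDiff ℝ ∞ U) (hf : DiffPoly U f) : ContDiff ℝ ∞ f := by
  induction hf with
  | const c => exact contDiff_const
  | deriv i w => exact contDiff_DU hU _
  | add _ _ hf hg => exact hf.add hg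
  | mul _ _ hf hg => exact hf.mul hg

lemma D (hU : ContDiff ℝ ∞ U) (hf : DiffPoly U f) (i : Fin d) : DiffPoly U (GCM.D i f) := by
  induction hf with
  | const c => rw [D_const]; exact const 0
  | deriv j w => exact deriv i (j :: w)
  | add hf hg hf' hg' =>
    rw [D_add (hf.contDiff hU) (hg.contDiff hU)]; exact hf'.add hg'
  | mul hf hg hf' hg' =>
    rw [D_mul (hf.contDiff hU) (hg.contDiff hU)]; exact (hf'.mul hg).add (hf.mul hg')

lemma memLp {μ : Measure (E d)} [IsProbabilityMeasure μ] (h : Regular μ U) (hf : DiffPoly U f)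
    (p : ℝ≥0) : MemLp f p μ := by
  induction hf generalizing p with
  | const c => exact memLp_const c
  | deriv i w =>
    obtain ⟨v, hv, hw⟩ := DU_eq_iteratedFDeriv h.smooth (i :: w)
    refine (h.mom (i :: w).length (by simp) p).mono
      (contDiff_DU h.smooth _).continuous.aestronglyMeasurable (Filter.Eventually.of_forall ?_)
    intro x
    rw [hw]
    refine (ContinuousMultilinearMap.le_opNorm _ _).trans ?_
    simp [hv]
  | add _ _ hf hg => exact (hf p).add (hg p)
  | mul _ _ hf hg =>
    -- Hölder with exponents `2p, 2p`: a product is in `L^p` when both factors are in `L^(2p)`,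
    -- which is why the induction runs over all `p` at once.
    have : ENNReal.HolderTriple ((2 * p : ℝ≥0) : ℝ≥0∞) ((2 * p : ℝ≥0) : ℝ≥0∞) p := by
      constructor
      rcases eq_or_ne p 0 with rfl | hp
      · simp
      · have hp' : (p : ℝ≥0∞) ≠ 0 := by simpa using hp
        push_cast
        rw [ENNReal.mul_inv (by simp) (by simp), ← add_mul, ENNReal.inv_two_add_inv_two, one_mul]
    exact (hg (2 * p)).mul' (hf (2 * p))

lemma memLp_two {μ : Measure (E d)} [IsProbabilityMeasure μ] (h : Regular μ U)
    (hf : DiffPoly U f) : MemLp f 2 μ := by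
  simpa using hf.memLp h 2

lemma integrable {μ : Measure (E d)} [IsProbabilityMeasure μ] (h : Regular μ U)
    (hf : DiffPoly U f) : Integrable f μ :=
  memLp_one_iff_integrable.1 (by simpa using hf.memLp h 1)

end DiffPoly

/-! ### Integration by parts against `e^U` -/

/-- The weighted partial derivative `∂ᵢ f + (∂ᵢ U) f`. -/
noncomputable def W (U : E d → ℝ) (i : Fin d) (f : E d → ℝ) (x : E d) : ℝ :=
  D i f x + D i U x * f x

lemma DiffPoly.W {U f : E d → ℝ} (hU : ContDiff ℝ ∞ U) (hf : DiffPoly U f) (i : Fin d) :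
    DiffPoly U (GCM.W U i f) :=
  (hf.D hU i).add ((DiffPoly.D_self i).mul hf)

section Divergence

variable {μ : Measure (E d)} {U : E d → ℝ}

lemma Regular.integral_eq (h : Regular μ U) (f : E d → ℝ) :
    ∫ x, f x ∂μ = ∫ x, f x * Real.exp (U x) := by
  have hm : Measurable fun x => ENNReal.ofReal (Real.exp (U x)) :=
    (Real.continuous_exp.comp h.smooth.continuous).measurable.ennreal_ofReal
  rw [h.dens, integral_withDensity_eq_integral_toReal_smul hm (by simp)]
  refine integral_congr_ae (Filter.Eventually.of_forall fun x => ?_)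
  simp [ENNReal.toReal_ofReal (Real.exp_pos _).le, mul_comm]

/-- The density is strictly positive. This upgrades almost everywhere equality of continuous
functions to equality, which is what makes contractions unique as smooth fields. -/
lemma Regular.isOpenPosMeasure (h : Regular μ U) : μ.IsOpenPosMeasure := by
  have hm : Measurable fun x => ENNReal.ofReal (Real.exp (U x)) :=
    (Real.continuous_exp.comp h.smooth.continuous).measurable.ennreal_ofReal
  have : volume ≪ μ := by
    rw [h.dens]
    refine withDensity_absolutelyContinuous' hm.aemeasurable
      (Filter.Eventually.of_forall fun x => ?_)
    simp [Real.exp_pos]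
  exact this.isOpenPosMeasure

lemma D_exp (hU : ContDiff ℝ ∞ U) (i : Fin d) :
    D i (fun x => Real.exp (U x)) = fun x => D i U x * Real.exp (U x) := by
  funext x
  simp only [D]
  rw [fderiv_exp (hU.differentiable (by simp) x)]
  simp [mul_comm]

lemma hasCompactSupport_D {f : E d → ℝ} (hf : HasCompactSupport f) (i : Fin d) :
    HasCompactSupport (D i f) := by
  refine (hf.fderiv (𝕜 := ℝ)).mono fun x hx => ?_
  contrapose! hx
  simp only [Function.mem_support, not_not] at hx ⊢
  simp [D, hx]

lemma Regular.integral_W_of_hasCompactSupport (h : Regular μ U) {f : E d → ℝ}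
    (hf : ContDiff ℝ ∞ f) (hc : HasCompactSupport f) (i : Fin d) : ∫ x, W U i f x ∂μ = 0 := by
  have hU := h.smooth
  have he : ContDiff ℝ ∞ fun x => Real.exp (U x) := hU.exp
  have i1 : Integrable (fun x => D i f x * Real.exp (U x)) :=
    ((contDiff_D hf i).continuous.mul he.continuous).integrable_of_hasCompactSupport
      (hasCompactSupport_D hc i).mul_right
  have i2 : Integrable (fun x => f x * D i (fun x => Real.exp (U x)) x) :=
    (hf.continuous.mul (contDiff_D he i).continuous).integrable_of_hasCompactSupport
      hc.mul_right
  have i3 : Integrable (fun x => f x * Real.exp (U x)) :=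
    (hf.continuous.mul he.continuous).integrable_of_hasCompactSupport hc.mul_right
  have key := integral_mul_fderiv_eq_neg_fderiv_mul_of_integrable (𝕜 := ℝ) (μ := volume)
    (v := EuclideanSpace.single i (1 : ℝ)) i1 i2 i3
    (fun x _ => hf.differentiable (by simp) x) (fun x _ => he.differentiable (by simp) x)
  change ∫ x, f x * D i (fun x => Real.exp (U x)) x = -∫ x, D i f x * Real.exp (U x) at key
  rw [h.integral_eq]
  have : ∀ x, W U i f x * Real.exp (U x) =
      D i f x * Real.exp (U x) + f x * D i (fun x => Real.exp (U x)) x := by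
    intro x; rw [D_exp hU]; simp only [W]; ring
  simp_rw [this]
  rw [integral_add i1 i2, key]
  ring

/-- A sequence of smooth cut-off functions with derivatives tending to zero. -/
lemma exists_cutoff (d : ℕ) : ∃ (χ : ℕ → E d → ℝ) (C : ℝ),
    (∀ n, ContDiff ℝ ∞ (χ n)) ∧ (∀ n, HasCompactSupport (χ n)) ∧
    (∀ n x, 0 ≤ χ n x ∧ χ n x ≤ 1) ∧
    (∀ x, ∃ N, ∀ n ≥ N, χ n x = 1) ∧ (∀ n i x, |D i (χ n) x| ≤ C / (n + 1)) := by
  let b : ContDiffBump (0 : E d) := ⟨1, 2, by norm_num, by norm_num⟩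
  have hb : ContDiff ℝ ∞ (b : E d → ℝ) := b.contDiff
  obtain ⟨C, hC⟩ := (hb.continuous_fderiv (by simp)).bounded_above_of_compact_support
    (b.hasCompactSupport.fderiv (𝕜 := ℝ))
  refine ⟨fun n x => b (((n : ℝ) + 1)⁻¹ • x), C, fun n => hb.comp (contDiff_const_smul _),
    fun n => ?_, fun n x => ⟨b.nonneg, b.le_one⟩, fun x => ?_, fun n i x => ?_⟩
  · exact b.hasCompactSupport.comp_homeomorph
      (Homeomorph.smulOfNeZero (((n : ℝ) + 1)⁻¹) (by positivity))
  · obtain ⟨N, hN⟩ := exists_nat_ge ‖x‖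
    refine ⟨N, fun n hn => b.one_of_mem_closedBall ?_⟩
    have hn' : (N : ℝ) ≤ n := by exact_mod_cast hn
    rw [mem_closedBall_zero_iff, norm_smul, norm_inv, Real.norm_of_nonneg (by positivity)]
    show _ ≤ (1 : ℝ)
    rw [inv_mul_le_iff₀ (by positivity)]
    linarith
  · have : fderiv ℝ (fun x => b (((n : ℝ) + 1)⁻¹ • x)) x =
        ((n : ℝ) + 1)⁻¹ • fderiv ℝ b (((n : ℝ) + 1)⁻¹ • x) := by
      exact fderiv_comp_smul (f := (b : E d → ℝ)) _
    rw [D, this]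
    rw [smul_apply, smul_eq_mul, abs_mul, abs_inv,
      abs_of_nonneg (by positivity : (0 : ℝ) ≤ n + 1), div_eq_inv_mul]
    gcongr
    refine ((fderiv ℝ b _).le_opNorm _).trans ?_
    simpa using hC _

/-- The divergence theorem for the measure `μ`. -/
lemma Regular.integral_sum_W [IsProbabilityMeasure μ] (h : Regular μ U) {V : Fin d → E d → ℝ}
    (hV : ∀ i, ContDiff ℝ ∞ (V i)) (hi : ∀ i, Integrable (V i) μ)
    (hs : Integrable (fun x => ∑ i, W U i (V i) x) μ) : ∫ x, ∑ i, W U i (V i) x ∂μ = 0 := by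
  -- Only the whole divergence is assumed integrable, not its separate terms: for a general test
  -- field `ξ` nothing is known about the individual derivatives of `ξ`. Hence the cut-off and
  -- dominated convergence.
  obtain ⟨χ, C, hχ, hc, h01, h1, hD⟩ := exists_cutoff d
  -- The sign of `C` is read off from the derivative bound at some coordinate; in dimension zero
  -- there is none, but then the sum is empty.
  have hC : 0 ≤ C ∨ IsEmpty (Fin d) := by
    by_cases hd : IsEmpty (Fin d)
    · exact Or.inr hd
    · rw [not_isEmpty_iff] at hd
      obtain ⟨i⟩ := hd
      left
      have := (abs_nonneg _).trans (hD 0 i 0)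
      simpa using this
  rcases hC with hC | hd
  swap
  · simp
  have hW : ∀ n i x, W U i (fun x => χ n x * V i x) x = χ n x * W U i (V i) x +
      D i (χ n) x * V i x := by
    intro n i x
    simp only [W]
    rw [D_mul (hχ n) (hV i)]
    ring
  have i2 : ∀ n i, Integrable (fun x => D i (χ n) x * V i x) μ := fun n i =>
    (hi i).bdd_mul (contDiff_D (hχ n) i).continuous.aestronglyMeasurable
      (Filter.Eventually.of_forall fun x => by simpa using hD n i x)
  have i1 : ∀ n, Integrable (fun x => χ n x * ∑ i, W U i (V i) x) μ := fun n =>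
    hs.bdd_mul (c := 1) (hχ n).continuous.aestronglyMeasurable
      (Filter.Eventually.of_forall fun x => by
        rw [Real.norm_of_nonneg (h01 n x).1]; exact (h01 n x).2)
  have i3 : ∀ n i, Integrable (W U i (fun x => χ n x * V i x)) μ := fun n i => by
    have hf : ContDiff ℝ ∞ fun x => χ n x * V i x := (hχ n).mul (hV i)
    have hcf : HasCompactSupport fun x => χ n x * V i x := (hc n).mul_right
    refine Continuous.integrable_of_hasCompactSupport
      ((contDiff_D hf i).continuous.add ((contDiff_D h.smooth i).continuous.mul hf.continuous))
      ((hasCompactSupport_D hcf i).add hcf.mul_left)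
  -- The compactly supported case applied to `χₙ V` leaves only the terms with `∂χₙ`, which are
  -- `O(1/(n+1))`.
  have eq : ∀ n, ∫ x, χ n x * ∑ i, W U i (V i) x ∂μ = -∑ i, ∫ x, D i (χ n) x * V i x ∂μ := by
    intro n
    have e0 : ∫ x, ∑ i, W U i (fun x => χ n x * V i x) x ∂μ = 0 := by
      rw [integral_finsetSum _ fun i _ => i3 n i]
      exact Finset.sum_eq_zero fun i _ =>
        h.integral_W_of_hasCompactSupport ((hχ n).mul (hV i)) (hc n).mul_right i
    simp_rw [hW, Finset.sum_add_distrib, ← Finset.mul_sum] at e0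
    rw [integral_add (i1 n) (integrable_finsetSum _ fun i _ => i2 n i),
      integral_finsetSum _ fun i _ => i2 n i] at e0
    linarith
  have lim1 : Filter.Tendsto (fun n => ∫ x, χ n x * ∑ i, W U i (V i) x ∂μ) Filter.atTop
      (nhds (∫ x, ∑ i, W U i (V i) x ∂μ)) := by
    refine tendsto_integral_of_dominated_convergence (fun x => ‖∑ i, W U i (V i) x‖)
      (fun n => (i1 n).aestronglyMeasurable) hs.norm (fun n => ?_) ?_
    · refine Filter.Eventually.of_forall fun x => ?_
      rw [norm_mul, Real.norm_of_nonneg (h01 n x).1]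
      exact mul_le_of_le_one_left (norm_nonneg _) (h01 n x).2
    · refine Filter.Eventually.of_forall fun x => ?_
      obtain ⟨N, hN⟩ := h1 x
      refine tendsto_const_nhds.congr' ?_
      filter_upwards [Filter.eventually_ge_atTop N] with n hn
      rw [hN n hn, one_mul]
  have lim2 : Filter.Tendsto (fun n => ∫ x, χ n x * ∑ i, W U i (V i) x ∂μ) Filter.atTop
      (nhds 0) := by
    refine squeeze_zero_norm (a := fun n : ℕ => (C * ∑ i, ∫ x, ‖V i x‖ ∂μ) / ((n : ℝ) + 1))
      (fun n => ?_) ?_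
    · rw [eq, norm_neg, Finset.mul_sum, Finset.sum_div]
      refine (norm_sum_le _ _).trans (Finset.sum_le_sum fun i _ => ?_)
      refine (norm_integral_le_integral_norm _).trans ?_
      rw [mul_div_right_comm, ← integral_const_mul]
      refine integral_mono (i2 n i).norm ((hi i).norm.const_mul _) fun x => ?_
      simp only [norm_mul]
      gcongr
      simpa using hD n i x
    · exact tendsto_const_nhds.div_atTop
        (Filter.tendsto_atTop_add_const_right _ _ tendsto_natCast_atTop_atTop)
  exact tendsto_nhds_unique lim1 lim2

end Divergence

/-! ### Fields with differential polynomial entries -/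

/-- Matrix fields whose entries are differential polynomials. -/
def DiffMat (U : E d → ℝ) (F : E d → Matrix (Fin d) (Fin d) ℝ) : Prop :=
  ∀ i j, DiffPoly U fun x => F x i j

/-- Vector fields whose components are differential polynomials. -/
def DiffField (U : E d → ℝ) (Φ : E d → E d) : Prop :=
  ∀ j, DiffPoly U fun x => Φ x j

namespace DiffMat

variable {U : E d → ℝ} {F G : E d → Matrix (Fin d) (Fin d) ℝ}

lemma const (A : Matrix (Fin d) (Fin d) ℝ) : DiffMat U fun _ => A :=
  fun i j => DiffPoly.const (A i j)

lemma mul (hF : DiffMat U F) (hG : DiffMat U G) : DiffMat U fun x => F x * G x := fun i j => by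
  simp only [Matrix.mul_apply]
  exact DiffPoly.sum _ fun k _ => (hF i k).mul (hG k j)

lemma trace (hF : DiffMat U F) : DiffPoly U fun x => (F x).trace :=
  DiffPoly.sum _ fun k _ => hF k k

lemma ofFn_prod {n : ℕ} {F : Fin n → E d → Matrix (Fin d) (Fin d) ℝ}
    (hF : ∀ k, DiffMat U (F k)) : DiffMat U fun x => (List.ofFn fun k => F k x).prod := by
  induction n with
  | zero => simpa using const 1
  | succ n ih =>
    simp only [List.ofFn_succ, List.prod_cons]
    exact (hF 0).mul (ih fun k => hF k.succ)

lemma pow (hF : DiffMat U F) (n : ℕ) : DiffMat U fun x => F x ^ n := by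
  induction n with
  | zero => simpa using const 1
  | succ n ih => simp only [pow_succ]; exact ih.mul hF

end DiffMat

lemma DiffField.contDiff {U : E d → ℝ} (hU : ContDiff ℝ ∞ U) {Φ : E d → E d}
    (hΦ : DiffField U Φ) : ContDiff ℝ ∞ Φ :=
  contDiff_euclidean.2 fun j => (hΦ j).contDiff hU

lemma gradMatrix_apply {Φ : E d → E d} (hΦ : ContDiff ℝ ∞ Φ) (x : E d) (i j : Fin d) :
    gradMatrix Φ x i j = D i (fun y => Φ y j) x := by
  have h := (EuclideanSpace.proj j : E d →L[ℝ] ℝ).hasFDerivAt.comp x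
    (hΦ.differentiable (by simp) x).hasFDerivAt
  exact (congrArg (fun A => A (EuclideanSpace.single i (1 : ℝ))) h.fderiv).symm

lemma DiffField.gradMatrix {U : E d → ℝ} (hU : ContDiff ℝ ∞ U) {Φ : E d → E d}
    (hΦ : DiffField U Φ) : DiffMat U (GCM.gradMatrix Φ) := fun i j => by
  simp_rw [gradMatrix_apply (hΦ.contDiff hU)]
  exact (hΦ j).D hU i

lemma DiffField.isSmoothL2 {μ : Measure (E d)} [IsProbabilityMeasure μ] {U : E d → ℝ}
    (h : Regular μ U) {Φ : E d → E d} (hΦ : DiffField U Φ) : IsSmoothL2 μ Φ :=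
  ⟨hΦ.contDiff h.smooth, MemLp.of_eval_piLp fun j => (hΦ j).memLp_two h⟩

/-! ### The form `Λₙ` and its contractions -/

section Lam

variable {ι : Type} [Fintype ι]

open Classical in
/-- The symmetric multilinear form `Λₙ` on matrices. -/
noncomputable def lamMat (d : ℕ) (ι : Type) [Fintype ι] :
    MultilinearMap ℝ (fun _ : ι => Matrix (Fin d) (Fin d) ℝ) ℝ :=
  ((-1) ^ Fintype.card ι * (1 / (Fintype.card ι : ℝ))) •
    ∑ e : Fin (Fintype.card ι) ≃ ι,
      (Matrix.traceLinearMap (Fin d) ℝ ℝ).compMultilinearMap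
        ((MultilinearMap.mkPiAlgebraFin ℝ (Fintype.card ι)
          (Matrix (Fin d) (Fin d) ℝ)).domDomCongr e)

open Classical in
lemma lamMat_apply (B : ι → Matrix (Fin d) (Fin d) ℝ) :
    lamMat d ι B = (-1) ^ Fintype.card ι * (1 / (Fintype.card ι : ℝ)) *
      ∑ e : Fin (Fintype.card ι) ≃ ι, ((List.ofFn fun k => B (e k)).prod).trace := by
  simp [lamMat]

lemma Lam_eq_lamMat (Φ : ι → E d → E d) (x : E d) :
    Lam Φ x = lamMat d ι fun k => gradMatrix (Φ k) x := by
  rw [lamMat_apply]; rfl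

open Classical in
lemma lamMat_of_card {n : ℕ} (hn : Fintype.card ι = n) (B : ι → Matrix (Fin d) (Fin d) ℝ) :
    lamMat d ι B = (-1) ^ n * (1 / (n : ℝ)) *
      ∑ e : Fin n ≃ ι, ((List.ofFn fun k => B (e k)).prod).trace := by
  subst hn; exact lamMat_apply B

lemma lamMat_comp_equiv {κ : Type} [Fintype κ] (e : κ ≃ ι)
    (B : ι → Matrix (Fin d) (Fin d) ℝ) : lamMat d κ (B ∘ e) = lamMat d ι B := by
  classical
  rw [lamMat_of_card (Fintype.card_congr e), lamMat_of_card rfl]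
  congr 1
  exact Fintype.sum_equiv (Equiv.equivCongr (Equiv.refl _) e) _ _ fun f => rfl

lemma Lam_comp_equiv {κ : Type} [Fintype κ] (e : κ ≃ ι) (Φ : ι → E d → E d) :
    Lam (Φ ∘ e) = Lam Φ := by
  funext x
  rw [Lam_eq_lamMat, Lam_eq_lamMat]
  exact lamMat_comp_equiv e fun k => gradMatrix (Φ k) x

lemma diffPoly_lamMat {U : E d → ℝ} {B : ι → E d → Matrix (Fin d) (Fin d) ℝ}
    (hB : ∀ k, DiffMat U (B k)) : DiffPoly U fun x => lamMat d ι fun k => B k x := by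
  simp only [lamMat_apply]
  exact (DiffPoly.sum _ fun e _ => (DiffMat.ofFn_prod fun k => hB (e k)).trace).const_mul _

lemma DiffField.Lam {U : E d → ℝ} (hU : ContDiff ℝ ∞ U) {Φ : ι → E d → E d}
    (hΦ : ∀ k, DiffField U (Φ k)) : DiffPoly U (GCM.Lam Φ) := by
  simp_rw [funext (Lam_eq_lamMat Φ)]
  exact diffPoly_lamMat fun k => (hΦ k).gradMatrix hU

/-- If all factors but one are `H`, the product has the form `H^a B H^b`, so by cyclicity its trace
does not depend on the position of `B`. -/
lemma ofFn_prod_const_off {n : ℕ} {H : Matrix (Fin d) (Fin d) ℝ} (p : Fin (n + 1))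
    (f : Fin (n + 1) → Matrix (Fin d) (Fin d) ℝ) (hf : ∀ k, k ≠ p → f k = H) :
    ∃ a b, a + b = n ∧ (List.ofFn f).prod = H ^ a * f p * H ^ b := by
  induction n with
  | zero => exact ⟨0, 0, rfl, by
    obtain rfl : p = 0 := Fin.fin_one_eq_zero p
    simp⟩
  | succ n ih =>
    rw [List.ofFn_succ, List.prod_cons]
    rcases Fin.eq_zero_or_eq_succ p with rfl | ⟨q, rfl⟩
    · refine ⟨0, n + 1, by omega, ?_⟩
      have : (fun k : Fin (n + 1) => f k.succ) = fun _ => H :=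
        funext fun k => hf _ (Fin.succ_ne_zero k)
      rw [this]
      simp [pow_succ']
    · obtain ⟨a, b, hab, h⟩ := ih q (fun k => f k.succ)
        fun k hk => hf _ fun h => hk (Fin.succ_injective _ h)
      refine ⟨a + 1, b, by omega, ?_⟩
      rw [h, hf 0 (Fin.succ_ne_zero q).symm, pow_succ']
      simp only [mul_assoc]

/-- All `(n+1)!` orderings have the same trace, and the factor `1/(n+1)` leaves `n!`. -/
lemma lamMat_const_off {n : ℕ} (hn : Fintype.card ι = n + 1) (j : ι)
    {H : Matrix (Fin d) (Fin d) ℝ} {B : ι → Matrix (Fin d) (Fin d) ℝ}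
    (hB : ∀ k, k ≠ j → B k = H) :
    lamMat d ι B = (-1) ^ (n + 1) * (n.factorial : ℝ) * (H ^ n * B j).trace := by
  classical
  rw [lamMat_of_card hn]
  have : ∀ e : Fin (n + 1) ≃ ι,
      ((List.ofFn fun k => B (e k)).prod).trace = (H ^ n * B j).trace := by
    intro e
    obtain ⟨a, b, hab, h⟩ := ofFn_prod_const_off (e.symm j) (fun k => B (e k))
      fun k hk => hB _ fun h => hk (by rw [← h, e.symm_apply_apply])
    rw [h, Matrix.trace_mul_comm, ← mul_assoc, ← pow_add, add_comm, hab]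
    simp
  rw [Finset.sum_congr rfl fun e _ => this e, Finset.sum_const, Finset.card_univ,
    Fintype.card_equiv (Fintype.equivOfCardEq (by simp [hn])), Fintype.card_fin, nsmul_eq_mul,
    Nat.factorial_succ]
  push_cast
  have : ((n : ℝ) + 1) ≠ 0 := by positivity
  field_simp

lemma Lam_const_off {n : ℕ} (hn : Fintype.card ι = n + 1) (j : ι) {φ : E d → E d}
    {Φ : ι → E d → E d} (hΦ : ∀ k, k ≠ j → Φ k = φ) (x : E d) :
    Lam Φ x = (-1) ^ (n + 1) * (n.factorial : ℝ) *
      (gradMatrix φ x ^ n * gradMatrix (Φ j) x).trace := by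
  rw [Lam_eq_lamMat]
  exact lamMat_const_off hn j fun k hk => by rw [hΦ k hk]

open Classical in
/-- The coefficient of `∂ᵢ ξ^l` in `Λₙ(Φ with ξ in slot j)`. -/
noncomputable def coef (Φ : ι → E d → E d) (j : ι) (i l : Fin d) (x : E d) : ℝ :=
  lamMat d ι (Function.update (fun k => gradMatrix (Φ k) x) j (Matrix.single i l 1))

open Classical in
lemma Lam_update (Φ : ι → E d → E d) (j : ι) (ξ : E d → E d) (x : E d) :
    Lam (Function.update Φ j ξ) x = ∑ i, ∑ l, gradMatrix ξ x i l * coef Φ j i l x := by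
  have : (fun k => gradMatrix (Function.update Φ j ξ k) x) =
      Function.update (fun k => gradMatrix (Φ k) x) j (gradMatrix ξ x) := by
    funext k
    by_cases hk : k = j
    · subst hk; simp
    · simp [hk]
  rw [Lam_eq_lamMat, this]
  conv_lhs => rw [Matrix.matrix_eq_sum_single (gradMatrix ξ x)]
  rw [MultilinearMap.map_update_sum]
  refine Finset.sum_congr rfl fun i _ => ?_
  rw [MultilinearMap.map_update_sum]
  refine Finset.sum_congr rfl fun l _ => ?_
  rw [coef, ← smul_eq_mul, ← MultilinearMap.map_update_smul, Matrix.smul_single]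
  simp

lemma coef_const_off {n : ℕ} (hn : Fintype.card ι = n + 1) (j : ι) {φ : E d → E d}
    {Φ : ι → E d → E d} (hΦ : ∀ k, k ≠ j → Φ k = φ) (i l : Fin d) (x : E d) :
    coef Φ j i l x = (-1) ^ (n + 1) * (n.factorial : ℝ) * (gradMatrix φ x ^ n) l i := by
  classical
  rw [coef, lamMat_const_off hn j (H := gradMatrix φ x)]
  · simp [Matrix.trace_mul_single]
  · intro k hk
    rw [Function.update_of_ne hk, hΦ k hk]

lemma coef_congr {Φ Φ' : ι → E d → E d} {j : ι} (h : ∀ k, k ≠ j → Φ k = Φ' k) :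
    coef Φ j = coef Φ' j := by
  funext i l x
  simp only [coef]
  congr 1
  funext k
  by_cases hk : k = j
  · subst hk; simp
  · simp [hk, h k hk]

lemma diffPoly_coef {U : E d → ℝ} (hU : ContDiff ℝ ∞ U) {Φ : ι → E d → E d} {j : ι}
    (hΦ : ∀ k, k ≠ j → DiffField U (Φ k)) (i l : Fin d) : DiffPoly U (coef Φ j i l) := by
  classical
  have : coef Φ j i l = fun x => lamMat d ι fun k =>
      Function.update (fun k => gradMatrix (Φ k)) j (fun _ => Matrix.single i l 1) k x := by
    funext x
    rw [coef]
    congr 1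
    funext k
    by_cases hk : k = j
    · subst hk; simp
    · simp [hk]
  rw [this]
  refine diffPoly_lamMat fun k => ?_
  by_cases hk : k = j
  · subst hk; simpa using DiffMat.const _
  · simpa [hk] using (hΦ k hk).gradMatrix hU

/-- The contraction of `Λ^{(n,μ)}` with the fields `Φ k`, `k ≠ j`, in closed form. -/
noncomputable def contr (U : E d → ℝ) (Φ : ι → E d → E d) (j : ι) (x : E d) : E d :=
  WithLp.toLp 2 fun l => -∑ i, W U i (coef Φ j i l) x

/-- The field in the free slot is overwritten and does not matter. This is what allows branch fields
to be computed recursively, away from the edge being cut. -/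
lemma contr_congr (U : E d → ℝ) {Φ Φ' : ι → E d → E d} {j : ι}
    (h : ∀ k, k ≠ j → Φ k = Φ' k) : contr U Φ j = contr U Φ' j := by
  funext x
  simp only [contr, coef_congr h]

lemma diffField_contr {U : E d → ℝ} (hU : ContDiff ℝ ∞ U) {Φ : ι → E d → E d} {j : ι}
    (hΦ : ∀ k, k ≠ j → DiffField U (Φ k)) : DiffField U (contr U Φ j) := fun l =>
  (DiffPoly.sum _ fun i _ => (diffPoly_coef hU hΦ i l).W hU i).neg

lemma inner_eq_sum (v w : E d) : inner ℝ v w = ∑ l, v l * w l := by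
  simp [PiLp.inner_apply, mul_comm]

variable {μ : Measure (E d)} [IsProbabilityMeasure μ] {U : E d → ℝ}

omit [IsProbabilityMeasure μ] in
lemma integrable_mul {f g : E d → ℝ} (hf : MemLp f 2 μ) (hg : MemLp g 2 μ) :
    Integrable (fun x => f x * g x) μ := hf.integrable_mul hg

/-- The divergence theorem is applied to `Vᵢ = ∑ₗ ξˡ coefᵢₗ`, whose weighted divergence is `Λₙ(Φ, ξ)
- ⟨ξ, Ψ⟩`. Each `Vᵢ` is integrable as a sum of products of `L²` functions, and the divergence is
integrable exactly because `Λₙ(Φ, ξ)` is assumed so. -/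
lemma isContraction_contr (h : Regular μ U) {Φ : ι → E d → E d} {j : ι}
    (hΦ : ∀ k, k ≠ j → DiffField U (Φ k)) : IsContraction μ Φ j (contr U Φ j) := by
  classical
  have hc := diffField_contr h.smooth hΦ
  refine ⟨hc.isSmoothL2 h, fun ξ hξ hint => ?_⟩
  have hξl : ∀ l, ContDiff ℝ ∞ fun x => ξ x l := contDiff_euclidean.1 hξ.1
  have hξ2 : ∀ l, MemLp (fun x => ξ x l) 2 μ := fun l => hξ.2.eval_piLp l
  have hcoef := diffPoly_coef h.smooth hΦ
  have hin : Integrable (fun x => inner ℝ (ξ x) (contr U Φ j x)) μ := by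
    simp_rw [inner_eq_sum]
    exact integrable_finsetSum _ fun l _ => integrable_mul (hξ2 l) ((hc l).memLp_two h)
  have key : ∀ x, ∑ i, W U i (fun x => ∑ l, ξ x l * coef Φ j i l x) x =
      Lam (Function.update Φ j ξ) x - inner ℝ (ξ x) (contr U Φ j x) := by
    intro x
    rw [Lam_update, inner_eq_sum]
    simp only [contr, mul_neg, Finset.sum_neg_distrib, sub_neg_eq_add, Finset.mul_sum]
    rw [Finset.sum_comm (f := fun l i => ξ x l * W U i (coef Φ j i l) x),
      ← Finset.sum_add_distrib]
    refine Finset.sum_congr rfl fun i _ => ?_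
    rw [W, D_sum _ fun l _ => (hξl l).mul ((hcoef i l).contDiff h.smooth), Finset.mul_sum,
      ← Finset.sum_add_distrib, ← Finset.sum_add_distrib]
    refine Finset.sum_congr rfl fun l _ => ?_
    rw [D_mul (hξl l) ((hcoef i l).contDiff h.smooth), gradMatrix_apply hξ.1, W]
    ring
  have h0 := h.integral_sum_W (V := fun i x => ∑ l, ξ x l * coef Φ j i l x)
    (fun i => ContDiff.sum fun l _ => (hξl l).mul ((hcoef i l).contDiff h.smooth))
    (fun i => integrable_finsetSum _ fun l _ =>
      integrable_mul (hξ2 l) ((hcoef i l).memLp_two h))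
    (by simp_rw [key]; exact hint.sub hin)
  simp_rw [key] at h0
  rw [integral_sub hint hin] at h0
  linarith

/-- Two contractions are compared on the test field `χ w`, with `w` their difference and `χ` a
cut-off equal to `1` at the given point. Compact support makes the test admissible, and `∫ χ‖w‖² =
0` forces `w` to vanish there. -/
lemma IsContraction.eq_contr (h : Regular μ U) {Φ : ι → E d → E d} {j : ι}
    (hΦ : ∀ k, k ≠ j → DiffField U (Φ k)) {Ψ : E d → E d} (hΨ : IsContraction μ Φ j Ψ) :
    Ψ = contr U Φ j := by
  classical
  have hopen := h.isOpenPosMeasure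
  obtain ⟨hs, hc⟩ := isContraction_contr h hΦ
  obtain ⟨χ, C, hχ, hcs, h01, h1, -⟩ := exists_cutoff d
  funext x₀
  obtain ⟨n, hn⟩ := h1 x₀
  have hn := hn n le_rfl
  set w : E d → E d := fun x => Ψ x - contr U Φ j x with hw
  have hws : ContDiff ℝ ∞ w := hΨ.1.1.sub hs.1
  set ξ : E d → E d := fun x => χ n x • w x with hξ
  have hξs : ContDiff ℝ ∞ ξ := (hχ n).smul hws
  have hξc : HasCompactSupport ξ := (hcs n).smul_right
  have hξ2 : IsSmoothL2 μ ξ := ⟨hξs, hξs.continuous.memLp_of_hasCompactSupport hξc⟩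
  have hint : Integrable (Lam (Function.update Φ j ξ)) μ := by
    simp_rw [funext (Lam_update Φ j ξ), gradMatrix_apply hξs]
    refine integrable_finsetSum _ fun i _ => integrable_finsetSum _ fun l _ => ?_
    have hl : ContDiff ℝ ∞ fun x => ξ x l := contDiff_euclidean.1 hξs l
    have hlc : HasCompactSupport fun x => ξ x l :=
      hξc.comp_left (g := fun v : E d => v l) rfl
    exact Continuous.integrable_of_hasCompactSupport
      ((contDiff_D hl i).continuous.mul
        ((diffPoly_coef h.smooth hΦ i l).contDiff h.smooth).continuous)
      (hasCompactSupport_D hlc i).mul_right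
  have e1 := hΨ.2 ξ hξ2 hint
  have e2 := hc ξ hξ2 hint
  have i1 : ∀ {Ψ' : E d → E d}, Continuous Ψ' →
      Integrable (fun x => inner ℝ (ξ x) (Ψ' x)) μ := fun hΨ' => by
    refine (hξs.continuous.inner hΨ').integrable_of_hasCompactSupport ?_
    refine hξc.mono fun x hx => ?_
    contrapose! hx
    simp only [Function.mem_support, not_not] at hx ⊢
    rw [hx, inner_zero_left]
  have e3 : ∫ x, χ n x * ‖w x‖ ^ 2 ∂μ = 0 := by
    have : ∀ x, χ n x * ‖w x‖ ^ 2 = inner ℝ (ξ x) (Ψ x) - inner ℝ (ξ x) (contr U Φ j x) := by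
      intro x
      rw [← inner_sub_right, hξ, real_inner_smul_left, real_inner_self_eq_norm_sq]
    simp_rw [this]
    rw [integral_sub (i1 hΨ.1.1.continuous) (i1 hs.1.continuous), e1, e2, sub_self]
  have hcont : Continuous fun x => χ n x * ‖w x‖ ^ 2 :=
    (hχ n).continuous.mul (hws.continuous.norm.pow 2)
  have e4 := (integral_eq_zero_iff_of_nonneg
    (fun x => mul_nonneg (h01 n x).1 (sq_nonneg _))
    (hcont.integrable_of_hasCompactSupport (hcs n).mul_right)).1 e3
  have e5 : χ n x₀ * ‖w x₀‖ ^ 2 = 0 :=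
    congrFun (Continuous.ae_eq_iff_eq μ hcont continuous_const |>.1 e4) x₀
  rw [hn, one_mul] at e5
  have e6 : w x₀ = 0 := by simpa using e5
  exact sub_eq_zero.1 e6

omit [IsProbabilityMeasure μ] in
lemma IsContraction.congr {Φ Φ' : ι → E d → E d} {j : ι} (hΦ : ∀ k, k ≠ j → Φ k = Φ' k)
    {Ψ : E d → E d} (hΨ : IsContraction μ Φ j Ψ) : IsContraction μ Φ' j Ψ := by
  classical
  have : ∀ ξ, Function.update Φ j ξ = Function.update Φ' j ξ := by
    intro ξ
    funext k
    by_cases hk : k = j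
    · subst hk; simp
    · simp [hk, hΦ k hk]
  simpa only [IsContraction, this] using hΨ

omit [IsProbabilityMeasure μ] in
lemma IsContraction.integral_inner {Φ : ι → E d → E d} {j : ι} {Ψ : E d → E d}
    (hΨ : IsContraction μ Φ j Ψ) (hj : IsSmoothL2 μ (Φ j)) (hi : Integrable (Lam Φ) μ) :
    ∫ x, inner ℝ (Φ j x) (Ψ x) ∂μ = ∫ x, Lam Φ x ∂μ := by
  have := hΨ.2 (Φ j) hj
  simp only [Function.update_eq_self] at this
  exact this hi

omit [IsProbabilityMeasure μ] in
lemma IsContraction.comp_equiv {κ : Type} [Fintype κ] (e : κ ≃ ι) {Φ : ι → E d → E d} {j : κ}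
    {Ψ : E d → E d} (hΨ : IsContraction μ Φ (e j) Ψ) : IsContraction μ (Φ ∘ e) j Ψ := by
  classical
  have : ∀ ξ, Lam (Function.update (Φ ∘ e) j ξ) = Lam (Function.update Φ (e j) ξ) := by
    intro ξ
    rw [← Lam_comp_equiv e]
    congr 1
    funext k
    by_cases hk : k = j
    · subst hk; simp
    · simp [hk]
  refine ⟨hΨ.1, fun ξ hξ hi => ?_⟩
  have h1 := hΨ.2 ξ hξ
  rw [← this ξ] at h1
  exact h1 hi

end Lam

/-! ### Order of evaluation on trees -/

/-- A graph whose tree products can be evaluated: the branches at directed edges can be computed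
recursively, and quantities preserved along edges are constant. -/
structure Evaluable {V : Type} (G : SimpleGraph V) : Prop where
  -- The branch at `x` towards `y` is built from the branches at the other neighbours `z` of `x`
  -- towards `x`; the rank makes this recursion terminate.
  rank : ∃ r : V → V → ℕ, ∀ x y z, G.Adj x y → G.Adj x z → z ≠ y → r z x < r x y
  const : ∀ f : V → ℝ, (∀ x y, G.Adj x y → f x = f y) → ∀ x y, f x = f y

lemma Evaluable.of_iso {V V' : Type} {G : SimpleGraph V} {G' : SimpleGraph V'} (φ : G ≃g G')
    (h : Evaluable G') : Evaluable G := by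
  obtain ⟨r, hr⟩ := h.rank
  refine ⟨⟨fun x y => r (φ x) (φ y), fun x y z hxy hxz hzy => hr _ _ _ (φ.map_adj_iff.2 hxy)
    (φ.map_adj_iff.2 hxz) fun h => hzy (φ.injective h)⟩, fun f hf x y => ?_⟩
  have := h.const (f ∘ φ.symm) (fun a b hab => hf _ _ (φ.symm.map_adj_iff.2 hab)) (φ x) (φ y)
  simpa using this

section AddLeaf

variable {n : ℕ} {T : SimpleGraph (Fin n)} {x : Fin n}

lemma addLeaf_adj_castSucc (a b : Fin n) :
    (addLeaf T x).Adj a.castSucc b.castSucc ↔ T.Adj a b := by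
  simp only [addLeaf, SimpleGraph.sup_adj, SimpleGraph.edge_adj]
  have := (Fin.castSuccEmb (n := n)).injective
  rw [show a.castSucc = Fin.castSuccEmb a from rfl, show b.castSucc = Fin.castSuccEmb b from rfl,
    SimpleGraph.map_adj_apply]
  simp [Fin.castSucc_ne_last]

lemma addLeaf_adj_last (b : Fin n) : (addLeaf T x).Adj b.castSucc (Fin.last n) ↔ b = x := by
  simp only [addLeaf, SimpleGraph.sup_adj, SimpleGraph.edge_adj, SimpleGraph.map_adj]
  constructor
  · rintro (⟨a, c, -, -, hc⟩ | h)
    · exact absurd hc (Fin.castSucc_ne_last c)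
    · simpa [Fin.castSucc_ne_last] using h
  · rintro rfl
    exact Or.inr (by simp [Fin.castSucc_ne_last])

lemma Evaluable.addLeaf (h : Evaluable T) (x : Fin n) : Evaluable (GCM.addLeaf T x) := by
  obtain ⟨r, hr⟩ := h.rank
  refine ⟨?_, fun f hf => ?_⟩
  · let N := ∑ a, ∑ b, (r a b + 2)
    have hN : ∀ a b, r a b + 2 ≤ N := fun a b =>
      (Finset.single_le_sum (f := fun b => r a b + 2) (fun _ _ => Nat.zero_le _)
        (Finset.mem_univ b)).trans
      (Finset.single_le_sum (f := fun a => ∑ b, (r a b + 2)) (fun _ _ => Nat.zero_le _)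
        (Finset.mem_univ a))
    -- Ranks after adding a leaf: the leaf as a branch needs nothing and gets `0`; old branches may
    -- now use it and are shifted by one; a branch towards the leaf may use any old branch, hence
    -- `N`.
    refine ⟨Fin.lastCases (fun _ => 0) fun a => Fin.lastCases N fun b => r a b + 1, ?_⟩
    intro a b c
    refine Fin.lastCases ?_ (fun a => ?_) a
    · refine Fin.lastCases ?_ (fun b => ?_) b
      · simp
      · refine Fin.lastCases ?_ (fun c => ?_) c
        · simp
        · intro h1 h2 h3
          rw [SimpleGraph.adj_comm, addLeaf_adj_last] at h1 h2
          exact absurd (congrArg Fin.castSucc (h2.trans h1.symm)) h3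
    · refine Fin.lastCases ?_ (fun b => ?_) b
      · refine Fin.lastCases ?_ (fun c => ?_) c
        · simp
        · intro h1 h2 h3
          have := hN c a
          simp
          omega
      · refine Fin.lastCases ?_ (fun c => ?_) c
        · intro h1 h2 h3
          simp
        · intro h1 h2 h3
          rw [addLeaf_adj_castSucc] at h1 h2
          have := hr a b c h1 h2 fun h => h3 (congrArg _ h)
          simpa using this
  · have h1 := h.const (fun a => f a.castSucc) fun a b hab =>
      hf _ _ ((addLeaf_adj_castSucc a b).2 hab)
    have h2 : ∀ a, f a = f x.castSucc := by
      intro a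
      refine Fin.lastCases ?_ (fun a => ?_) a
      · exact (hf _ _ ((addLeaf_adj_last x).2 rfl)).symm
      · exact h1 a x
    intro a b
    rw [h2 a, h2 b]

/-- Isomorphisms extend to trees with an additional leaf. -/
def addLeafIso {T T' : SimpleGraph (Fin n)} (φ : T ≃g T') (x : Fin n) :
    addLeaf T x ≃g addLeaf T' (φ x) where
  toFun := Fin.lastCases (Fin.last n) fun a => (φ a).castSucc
  invFun := Fin.lastCases (Fin.last n) fun a => (φ.symm a).castSucc
  left_inv a := by refine Fin.lastCases ?_ (fun a => ?_) a <;> simp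
  right_inv a := by refine Fin.lastCases ?_ (fun a => ?_) a <;> simp
  map_rel_iff' {a b} := by
    refine Fin.lastCases ?_ (fun a => ?_) a <;> refine Fin.lastCases ?_ (fun b => ?_) b
    · simp
    · simp only [Equiv.coe_fn_mk, Fin.lastCases_last, Fin.lastCases_castSucc]
      rw [SimpleGraph.adj_comm, addLeaf_adj_last, SimpleGraph.adj_comm, addLeaf_adj_last]
      exact φ.injective.eq_iff
    · simp only [Equiv.coe_fn_mk, Fin.lastCases_last, Fin.lastCases_castSucc]
      rw [addLeaf_adj_last, addLeaf_adj_last]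
      exact φ.injective.eq_iff
    · simp only [Equiv.coe_fn_mk, Fin.lastCases_castSucc]
      rw [addLeaf_adj_castSucc, addLeaf_adj_castSucc]
      exact φ.map_adj_iff

end AddLeaf

lemma evaluable_of_mem_forest {n : ℕ} {G : SimpleGraph (Fin (n + 1))} (hG : G ∈ forest n) :
    Evaluable G := by
  induction n with
  | zero =>
    obtain rfl : G = ⊥ := by simpa [forest] using hG
    exact ⟨⟨fun _ _ => 0, by simp⟩, fun f _ x y => by rw [Subsingleton.elim (α := Fin 1) x y]⟩
  | succ n ih =>
    simp only [forest, List.mem_flatMap, List.mem_map] at hG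
    obtain ⟨T, hT, x, -, rfl⟩ := hG
    exact (ih hT).addLeaf x

/-! ### Branch fields and the value of a tree -/

section Values

variable {V : Type} [Fintype V] {G : SimpleGraph V}

open Classical in
/-- `m` is the family of branch fields of `G`. -/
structure IsBranches (U : E d → ℝ) (G : SimpleGraph V) (m : V → V → E d → E d) : Prop where
  diffField : ∀ x y, DiffField U (m x y)
  eq_contr : ∀ x y (h : G.Adj x y), m x y = contr U (fun z : G.neighborSet x => m z x) ⟨y, h⟩

open Classical in
/-- Iterated approximations of the branch fields. -/
noncomputable def branchIter (U : E d → ℝ) (G : SimpleGraph V) : ℕ → V → V → E d → E d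
  | 0 => fun _ _ _ => 0
  | n + 1 => fun x y => if h : G.Adj x y then
      contr U (fun z : G.neighborSet x => branchIter U G n z x) ⟨y, h⟩ else fun _ => 0

open Classical in
lemma branchIter_of_adj (U : E d → ℝ) (n : ℕ) {x y : V} (h : G.Adj x y) :
    branchIter U G (n + 1) x y =
      contr U (fun z : G.neighborSet x => branchIter U G n z x) ⟨y, h⟩ :=
  dif_pos h

lemma diffField_zero (U : E d → ℝ) : DiffField U fun _ => 0 := fun _ => DiffPoly.const 0

lemma diffField_branchIter {U : E d → ℝ} (hU : ContDiff ℝ ∞ U) (n : ℕ) (x y : V) :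
    DiffField U (branchIter U G n x y) := by
  classical
  induction n generalizing x y with
  | zero => exact diffField_zero U
  | succ n ih =>
    by_cases h : G.Adj x y
    · rw [branchIter_of_adj U n h]
      exact diffField_contr hU fun k _ => ih _ _
    · have : branchIter U G (n + 1) x y = fun _ => 0 := dif_neg h
      rw [this]
      exact diffField_zero U

/-- Starting from zero fields, the branch at `x` towards `y` no longer changes once the number of
rounds exceeds its rank. `N` exceeds all ranks, and every iterate has differential polynomial
components. -/
lemma Evaluable.exists_isBranches (hG : Evaluable G) {U : E d → ℝ} (hU : ContDiff ℝ ∞ U) :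
    ∃ m, IsBranches U G m := by
  classical
  obtain ⟨r, hr⟩ := hG.rank
  have stab : ∀ n x y, G.Adj x y → r x y < n →
      branchIter U G (n + 1) x y = branchIter U G n x y := by
    intro n
    induction n with
    | zero => intro x y _ h; omega
    | succ n ih =>
      intro x y h hn
      rw [branchIter_of_adj U _ h, branchIter_of_adj U _ h]
      refine contr_congr U fun k hk => ?_
      exact ih _ _ k.2.symm (by
        have := hr x y k h k.2 fun e => hk (Subtype.ext e)
        omega)
  let N := ∑ a, ∑ b, (r a b + 1)
  have hN : ∀ a b, r a b + 1 ≤ N := fun a b =>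
    (Finset.single_le_sum (f := fun b => r a b + 1) (fun _ _ => Nat.zero_le _)
      (Finset.mem_univ b)).trans
    (Finset.single_le_sum (f := fun a => ∑ b, (r a b + 1)) (fun _ _ => Nat.zero_le _)
      (Finset.mem_univ a))
  refine ⟨branchIter U G N, ⟨diffField_branchIter hU N, fun x y h => ?_⟩⟩
  rw [← stab N x y h (hN x y), branchIter_of_adj U _ h]

variable {μ : Measure (E d)} [IsProbabilityMeasure μ] {U : E d → ℝ}

namespace IsBranches

variable {m : V → V → E d → E d}

open Classical in
lemma isContraction (h : Regular μ U) (hm : IsBranches U G m) {x y : V} (hxy : G.Adj x y) :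
    IsContraction μ (fun z : G.neighborSet x => m z x) ⟨y, hxy⟩ (m x y) := by
  rw [hm.eq_contr x y hxy]
  exact isContraction_contr h fun k _ => hm.diffField _ _

open Classical in
lemma integrable_Lam (h : Regular μ U) (hm : IsBranches U G m) (x : V) :
    Integrable (Lam fun z : G.neighborSet x => m z x) μ :=
  (DiffField.Lam h.smooth fun _ => hm.diffField _ _).integrable h

open Classical in
lemma integral_Lam_eq_inner (h : Regular μ U) (hm : IsBranches U G m) {x y : V}
    (hxy : G.Adj x y) :
    ∫ p, Lam (fun z : G.neighborSet x => m z x) p ∂μ = ∫ p, inner ℝ (m y x p) (m x y p) ∂μ := by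
  exact ((hm.isContraction h hxy).integral_inner ((hm.diffField y x).isSmoothL2 h)
    (hm.integrable_Lam h x)).symm

-- Across an edge both ends give the integral of the inner product of the two opposite branch
-- fields, so the value is constant along edges.
open Classical in
lemma integral_Lam_eq (h : Regular μ U) (hG : Evaluable G) (hm : IsBranches U G m) (x y : V) :
    ∫ p, Lam (fun z : G.neighborSet x => m z x) p ∂μ =
      ∫ p, Lam (fun z : G.neighborSet y => m z y) p ∂μ := by
  refine hG.const (fun x => ∫ p, Lam (fun z : G.neighborSet x => m z x) p ∂μ)
    (fun x y hxy => ?_) x y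
  rw [hm.integral_Lam_eq_inner h hxy, hm.integral_Lam_eq_inner h hxy.symm]
  simp_rw [real_inner_comm]

open Classical in
lemma isTreeVal_iff (h : Regular μ U) (hG : Evaluable G) (hm : IsBranches U G m) (x : V)
    (c : ℝ) : IsTreeVal μ G c ↔ c = ∫ p, Lam (fun z : G.neighborSet x => m z x) p ∂μ := by
  constructor
  · rintro ⟨m', h1, h2⟩
    obtain ⟨r, hr⟩ := hG.rank
    -- Any admissible family agrees with `m` on directed edges, by induction on the rank and
    -- uniqueness of contractions.
    have key : ∀ n x y, G.Adj x y → r x y < n → m' x y = m x y := by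
      intro n
      induction n with
      | zero => intro x y _ hn; omega
      | succ n ih =>
        intro x y hxy hn
        rw [hm.eq_contr x y hxy]
        refine IsContraction.eq_contr h (fun k _ => hm.diffField _ _)
          ((h1 x y hxy).congr fun k hk => ?_)
        exact ih _ _ k.2.symm (by
          have := hr x y k hxy k.2 fun e => hk (Subtype.ext e)
          omega)
    have hx := (h2 x).2
    rw [← hx]
    have : (fun z : G.neighborSet x => m' z x) = fun z : G.neighborSet x => m z x :=
      funext fun z => key _ _ _ z.2.symm (Nat.lt_succ_self _)
    rw [this]
  · rintro rfl
    refine ⟨m, fun x y hxy => hm.isContraction h hxy, fun y => ⟨hm.integrable_Lam h y, ?_⟩⟩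
    rw [hm.integral_Lam_eq h hG y x]

end IsBranches

lemma Evaluable.existsUnique_isTreeVal [Nonempty V] (hG : Evaluable G) (h : Regular μ U) :
    ∃! c, IsTreeVal μ G c := by
  obtain ⟨m, hm⟩ := hG.exists_isBranches h.smooth
  obtain ⟨x⟩ := ‹Nonempty V›
  simp_rw [hm.isTreeVal_iff h hG x]
  exact existsUnique_eq

omit [IsProbabilityMeasure μ] in
lemma treeVal_eq_of_isTreeVal (hu : ∃! c, IsTreeVal μ G c) {c : ℝ} (hc : IsTreeVal μ G c) :
    treeVal μ G = c := by
  have hex : ∃ c, IsTreeVal μ G c := ⟨c, hc⟩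
  rw [treeVal, dif_pos hex]
  exact hu.unique hex.choose_spec hc

open Classical in
lemma IsBranches.treeVal_eq_Lam {m : V → V → E d → E d} (hm : IsBranches U G m)
    (hG : Evaluable G) (h : Regular μ U) (x : V) :
    treeVal μ G = ∫ p, Lam (fun z : G.neighborSet x => m z x) p ∂μ := by
  have : Nonempty V := ⟨x⟩
  refine treeVal_eq_of_isTreeVal (hG.existsUnique_isTreeVal h)
    ((hm.isTreeVal_iff h hG x _).2 rfl)

lemma IsBranches.treeVal_eq_inner {m : V → V → E d → E d} (hm : IsBranches U G m)
    (hG : Evaluable G) (h : Regular μ U) {x y : V} (hxy : G.Adj x y) :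
    treeVal μ G = ∫ p, inner ℝ (m y x p) (m x y p) ∂μ := by
  classical
  rw [hm.treeVal_eq_Lam hG h x, ← hm.integral_Lam_eq_inner h hxy]

omit [IsProbabilityMeasure μ] in
lemma IsTreeVal.of_iso {V' : Type} [Fintype V'] {G' : SimpleGraph V'} (φ : G ≃g G') {c : ℝ}
    (hc : IsTreeVal μ G' c) : IsTreeVal μ G c := by
  classical
  obtain ⟨m, h1, h2⟩ := hc
  refine ⟨fun x y => m (φ x) (φ y), fun x y hxy => ?_, fun x => ?_⟩
  · exact (h1 (φ x) (φ y) (φ.map_adj_iff.2 hxy)).comp_equiv (φ.mapNeighborSet x)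
      (j := ⟨y, hxy⟩)
  · have := Lam_comp_equiv (φ.mapNeighborSet x) fun z : G'.neighborSet (φ x) => m z (φ x)
    have h := h2 (φ x)
    rw [← this] at h
    exact h

lemma treeVal_of_iso {V' : Type} [Fintype V'] [Nonempty V] [Nonempty V'] {G' : SimpleGraph V'}
    (hG : Evaluable G) (h : Regular μ U) (φ : G ≃g G') : treeVal μ G = treeVal μ G' := by
  obtain ⟨c, hc, -⟩ := (hG.of_iso φ.symm).existsUnique_isTreeVal h
  rw [treeVal_eq_of_isTreeVal ((hG.of_iso φ.symm).existsUnique_isTreeVal h) hc]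
  exact treeVal_eq_of_isTreeVal (hG.existsUnique_isTreeVal h) (hc.of_iso φ)

end Values

/-! ### Calculus of the generator `L` and of `K = -∇²U` -/

/-- The generator `L f = Δ f + ∇U · ∇f`. -/
noncomputable def Lop (U : E d → ℝ) (f : E d → ℝ) (x : E d) : ℝ := ∑ k, W U k (D k f) x

/-- The matrix field `K = -∇²U`. -/
noncomputable def negHess (U : E d → ℝ) (x : E d) : Matrix (Fin d) (Fin d) ℝ :=
  Matrix.of fun i j => -D i (D j U) x

/-- The entrywise partial derivative of a matrix field. -/
noncomputable def dM (k : Fin d) (F : E d → Matrix (Fin d) (Fin d) ℝ) (x : E d) :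
    Matrix (Fin d) (Fin d) ℝ :=
  Matrix.of fun i j => D k (fun y => F y i j) x

/-- The generator `L` acting entrywise on matrix fields. -/
noncomputable def LM (U : E d → ℝ) (F : E d → Matrix (Fin d) (Fin d) ℝ) (x : E d) :
    Matrix (Fin d) (Fin d) ℝ :=
  Matrix.of fun i j => Lop U (fun y => F y i j) x

/-- The contraction of `Λ^{(n+1,μ)}` with `n` copies of `φ`. -/
noncomputable def powContr (U : E d → ℝ) (n : ℕ) (φ : E d → E d) (x : E d) : E d :=
  WithLp.toLp 2 fun l => -∑ i, W U i
    (fun y => (-1) ^ (n + 1) * (n.factorial : ℝ) * (gradMatrix φ y ^ n) l i) x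

/-- The vector field `∇U`. -/
noncomputable def gradU (U : E d → ℝ) (x : E d) : E d := WithLp.toLp 2 fun l => D l U x

lemma contr_eq_powContr {ι : Type} [Fintype ι] {n : ℕ} (hn : Fintype.card ι = n + 1) (j : ι)
    {φ : E d → E d} {Φ : ι → E d → E d} (hΦ : ∀ k, k ≠ j → Φ k = φ) (U : E d → ℝ) :
    contr U Φ j = powContr U n φ := by
  funext x
  simp only [contr, powContr, funext (coef_const_off hn j hΦ _ _)]

section Calculus

variable {U : E d → ℝ}

lemma DiffPoly.Lop (hU : ContDiff ℝ ∞ U) {f : E d → ℝ} (hf : DiffPoly U f) :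
    DiffPoly U (GCM.Lop U f) :=
  DiffPoly.sum _ fun k _ => (hf.D hU k).W hU k

lemma DiffMat.negHess (U : E d → ℝ) : DiffMat U (GCM.negHess U) := fun i j =>
  DiffPoly.neg (DiffPoly.deriv i [j])

namespace DiffMat

variable {F G : E d → Matrix (Fin d) (Fin d) ℝ}

lemma dM (hU : ContDiff ℝ ∞ U) (hF : DiffMat U F) (k : Fin d) : DiffMat U (GCM.dM k F) :=
  fun i j => (hF i j).D hU k

lemma LM (hU : ContDiff ℝ ∞ U) (hF : DiffMat U F) : DiffMat U (GCM.LM U F) :=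
  fun i j => (hF i j).Lop hU

lemma sub (hF : DiffMat U F) (hG : DiffMat U G) : DiffMat U fun x => F x - G x :=
  fun i j => (hF i j).sub (hG i j)

lemma sum {ι : Type*} (s : Finset ι) {F : ι → E d → Matrix (Fin d) (Fin d) ℝ}
    (hF : ∀ a ∈ s, DiffMat U (F a)) : DiffMat U fun x => ∑ a ∈ s, F a x := fun i j => by
  simp only [Matrix.sum_apply]
  exact DiffPoly.sum _ fun a ha => hF a ha i j

end DiffMat

lemma dM_mul (hU : ContDiff ℝ ∞ U) {F G : E d → Matrix (Fin d) (Fin d) ℝ} (hF : DiffMat U F)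
    (hG : DiffMat U G) (k : Fin d) :
    dM k (fun x => F x * G x) = fun x => dM k F x * G x + F x * dM k G x := by
  funext x
  ext i j
  simp only [dM, Matrix.mul_apply, Matrix.of_apply, Matrix.add_apply]
  rw [D_sum _ fun m _ => ((hF i m).mul (hG m j)).contDiff hU, ← Finset.sum_add_distrib]
  refine Finset.sum_congr rfl fun m _ => ?_
  rw [D_mul ((hF i m).contDiff hU) ((hG m j).contDiff hU)]

lemma dM_add (hU : ContDiff ℝ ∞ U) {F G : E d → Matrix (Fin d) (Fin d) ℝ} (hF : DiffMat U F)
    (hG : DiffMat U G) (k : Fin d) :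
    dM k (fun x => F x + G x) = fun x => dM k F x + dM k G x := by
  funext x
  ext i j
  simp only [dM, Matrix.of_apply, Matrix.add_apply]
  rw [D_add ((hF i j).contDiff hU) ((hG i j).contDiff hU)]

lemma dM_sum (hU : ContDiff ℝ ∞ U) {ι : Type*} (s : Finset ι)
    {F : ι → E d → Matrix (Fin d) (Fin d) ℝ} (hF : ∀ a ∈ s, DiffMat U (F a)) (k : Fin d) :
    dM k (fun x => ∑ a ∈ s, F a x) = fun x => ∑ a ∈ s, dM k (F a) x := by
  funext x
  ext i j
  simp only [dM, Matrix.of_apply, Matrix.sum_apply]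
  rw [D_sum _ fun a ha => (hF a ha i j).contDiff hU]

lemma dM_comm (hU : ContDiff ℝ ∞ U) {F : E d → Matrix (Fin d) (Fin d) ℝ} (hF : DiffMat U F)
    (k l : Fin d) : dM k (dM l F) = dM l (dM k F) := by
  funext x
  ext i j
  exact congrFun (D_comm ((hF i j).contDiff hU) k l) x

lemma D_trace (hU : ContDiff ℝ ∞ U) {F : E d → Matrix (Fin d) (Fin d) ℝ} (hF : DiffMat U F)
    (k : Fin d) : D k (fun x => (F x).trace) = fun x => (dM k F x).trace := by
  simp only [Matrix.trace, Matrix.diag_apply]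
  rw [D_sum _ fun i _ => (hF i i).contDiff hU]
  rfl

lemma LM_eq_sum (U : E d → ℝ) (F : E d → Matrix (Fin d) (Fin d) ℝ) (x : E d) :
    LM U F x = ∑ k, (dM k (dM k F) x + D k U x • dM k F x) := by
  ext i j
  simp only [LM, Lop, W, dM, Matrix.of_apply, Matrix.sum_apply, Matrix.add_apply,
    Matrix.smul_apply, smul_eq_mul]

lemma LM_mul (hU : ContDiff ℝ ∞ U) {F G : E d → Matrix (Fin d) (Fin d) ℝ} (hF : DiffMat U F)
    (hG : DiffMat U G) (x : E d) :
    LM U (fun x => F x * G x) x =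
      LM U F x * G x + F x * LM U G x + (2 : ℝ) • ∑ k, dM k F x * dM k G x := by
  simp only [LM_eq_sum, Finset.sum_mul, Finset.mul_sum, Finset.smul_sum]
  rw [← Finset.sum_add_distrib, ← Finset.sum_add_distrib]
  refine Finset.sum_congr rfl fun k _ => ?_
  rw [dM_mul hU hF hG, dM_add hU ((hF.dM hU k).mul hG) (hF.mul (hG.dM hU k)),
    dM_mul hU (hF.dM hU k) hG, dM_mul hU hF (hG.dM hU k)]
  simp only [add_mul, mul_add, smul_add, smul_mul_assoc, mul_smul_comm, two_smul]
  abel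

/-- The commutator of `∂ₘ` and `L` comes only from differentiating the drift `∇U`, which produces
`-K`. -/
lemma D_Lop (hU : ContDiff ℝ ∞ U) {f : E d → ℝ} (hf : DiffPoly U f) (m : Fin d) (x : E d) :
    D m (Lop U f) x = Lop U (D m f) x - ∑ k, negHess U x m k * D k f x := by
  have e : Lop U f = fun x => ∑ k, W U k (D k f) x := rfl
  rw [e, D_sum _ fun k _ => ((hf.D hU k).W hU k).contDiff hU, Lop, ← Finset.sum_sub_distrib]
  refine Finset.sum_congr rfl fun k _ => ?_
  have e2 : W U k (D k f) = fun x => D k (D k f) x + D k U x * D k f x := rfl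
  rw [e2, D_add (((hf.D hU k).D hU k).contDiff hU)
    (((DiffPoly.D_self k).mul (hf.D hU k)).contDiff hU),
    D_mul ((DiffPoly.D_self k).contDiff hU) ((hf.D hU k).contDiff hU), W,
    D_comm ((hf.D hU k).contDiff hU) m k, D_comm (hf.contDiff hU) m k]
  simp only [negHess, Matrix.of_apply]
  ring

lemma dM_LM (hU : ContDiff ℝ ∞ U) {F : E d → Matrix (Fin d) (Fin d) ℝ} (hF : DiffMat U F)
    (m : Fin d) (x : E d) :
    dM m (LM U F) x = LM U (dM m F) x - ∑ k, negHess U x m k • dM k F x := by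
  ext i j
  simp only [dM, LM, Matrix.of_apply, Matrix.sub_apply, Matrix.sum_apply, Matrix.smul_apply,
    smul_eq_mul]
  exact D_Lop hU (hF i j) m x

lemma isSymm_negHess (hU : ContDiff ℝ ∞ U) (x : E d) : (negHess U x).IsSymm := by
  ext i j
  simp only [negHess, Matrix.transpose_apply, Matrix.of_apply, D_comm hU i j]

lemma isSymm_dM {F : E d → Matrix (Fin d) (Fin d) ℝ} (hF : ∀ x, (F x).IsSymm) (k : Fin d)
    (x : E d) : (dM k F x).IsSymm := by
  ext i j
  simp only [dM, Matrix.transpose_apply, Matrix.of_apply, (hF _).apply i j]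

lemma isSymm_LM {F : E d → Matrix (Fin d) (Fin d) ℝ} (hF : ∀ x, (F x).IsSymm) (x : E d) :
    (LM U F x).IsSymm := by
  ext i j
  simp only [LM, Matrix.transpose_apply, Matrix.of_apply, (hF _).apply i j]

lemma diffField_powContr (hU : ContDiff ℝ ∞ U) {φ : E d → E d} (hφ : DiffField U φ) (n : ℕ) :
    DiffField U (powContr U n φ) := fun l =>
  (DiffPoly.sum _ fun i _ => (((hφ.gradMatrix hU).pow n l i).const_mul _).W hU i).neg

lemma diffField_gradU (U : E d → ℝ) : DiffField U (gradU U) := fun l => DiffPoly.D_self l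

/-- `Λ₁(ξ) = -div ξ`, so a leaf is the field representing `-∫ div ξ dμ`. -/
lemma powContr_zero (U : E d → ℝ) (φ : E d → E d) : powContr U 0 φ = gradU U := by
  funext x
  ext l
  simp [powContr, gradU, W, D_const, Matrix.one_apply]

lemma gradMatrix_gradU (hU : ContDiff ℝ ∞ U) (x : E d) : gradMatrix (gradU U) x = -negHess U x := by
  ext i j
  rw [gradMatrix_apply ((diffField_gradU U).contDiff hU)]
  simp [gradU, negHess]

/-- For symmetric `∇φ` the contraction of `Λ₂` with `φ` is `-Lφ`; the term with `K` is the
commutator of `∇` and `L`. -/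
lemma gradMatrix_powContr_one (hU : ContDiff ℝ ∞ U) {φ : E d → E d} (hφ : DiffField U φ)
    (hs : ∀ x, (gradMatrix φ x).IsSymm) (x : E d) :
    gradMatrix (powContr U 1 φ) x = negHess U x * gradMatrix φ x - LM U (gradMatrix φ) x := by
  have hc := hφ.contDiff hU
  have e : ∀ l, (fun x => powContr U 1 φ x l) = fun x => -1 * Lop U (fun x => φ x l) x := by
    intro l
    funext x
    have e1 : ∀ i, (fun y => (-1) ^ (1 + 1) * ((1 : ℕ).factorial : ℝ) * (gradMatrix φ y ^ 1) l i)
        = D i (fun y => φ y l) := by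
      intro i
      funext y
      rw [pow_one, ← (hs y).apply, gradMatrix_apply hc]
      simp
    simp only [powContr, e1, Lop, neg_mul, one_mul]
  ext k l
  rw [gradMatrix_apply ((diffField_powContr hU hφ 1).contDiff hU), e,
    D_const_mul (((hφ l).Lop hU).contDiff hU)]
  simp only [D_Lop hU (hφ l)]
  simp only [Matrix.sub_apply, Matrix.mul_apply, LM, Matrix.of_apply]
  simp_rw [gradMatrix_apply hc]
  ring

end Calculus

/-! ### Symmetry of `L` under the trace pairing -/

section Integrals

variable {μ : Measure (E d)} [IsProbabilityMeasure μ] {U : E d → ℝ}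

lemma integral_trace_mul_LM (h : Regular μ U) {F G : E d → Matrix (Fin d) (Fin d) ℝ}
    (hF : DiffMat U F) (hG : DiffMat U G) :
    ∫ x, (F x * LM U G x).trace ∂μ = -∫ x, ∑ k, (dM k F x * dM k G x).trace ∂μ := by
  have hU := h.smooth
  have i1 : DiffPoly U fun x => (F x * LM U G x).trace := (hF.mul (hG.LM hU)).trace
  have i2 : DiffPoly U fun x => ∑ k, (dM k F x * dM k G x).trace :=
    DiffPoly.sum _ fun k _ => ((hF.dM hU k).mul (hG.dM hU k)).trace
  have hV : ∀ k, DiffPoly U fun x => (F x * dM k G x).trace := fun k =>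
    (hF.mul (hG.dM hU k)).trace
  have key : ∀ x, ∑ k, W U k (fun x => (F x * dM k G x).trace) x =
      (F x * LM U G x).trace + ∑ k, (dM k F x * dM k G x).trace := by
    intro x
    rw [LM_eq_sum, Finset.mul_sum, Matrix.trace_sum, ← Finset.sum_add_distrib]
    refine Finset.sum_congr rfl fun k _ => ?_
    rw [W, D_trace hU (hF.mul (hG.dM hU k)), dM_mul hU hF (hG.dM hU k)]
    simp only [Matrix.trace_add, mul_add, mul_smul_comm, Matrix.trace_smul, smul_eq_mul]
    ring
  have := h.integral_sum_W (fun k => (hV k).contDiff hU) (fun k => (hV k).integrable h)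
    (by simp_rw [key]; exact (i1.add i2).integrable h)
  simp_rw [key] at this
  rw [integral_add (i1.integrable h) (i2.integrable h)] at this
  linarith

lemma integral_trace_mul_LM_comm (h : Regular μ U) {F G : E d → Matrix (Fin d) (Fin d) ℝ}
    (hF : DiffMat U F) (hG : DiffMat U G) :
    ∫ x, (F x * LM U G x).trace ∂μ = ∫ x, (LM U F x * G x).trace ∂μ := by
  rw [integral_trace_mul_LM h hF hG]
  simp_rw [Matrix.trace_mul_comm (LM U F _)]
  rw [integral_trace_mul_LM h hG hF]
  simp_rw [Matrix.trace_mul_comm (dM _ F _)]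

end Integrals

/-! ### Trace inequalities and the sign of the Hessian -/

section Positivity

open Matrix

variable {n : Type} [Fintype n]

lemma trace_transpose_mul_self_nonneg (S : Matrix n n ℝ) : 0 ≤ (Sᵀ * S).trace := by
  simpa using (Matrix.posSemidef_conjTranspose_mul_self S).trace_nonneg

lemma trace_mul_self_nonneg {S : Matrix n n ℝ} (hS : S.IsSymm) : 0 ≤ (S * S).trace := by
  simpa [hS.eq] using trace_transpose_mul_self_nonneg S

lemma trace_mul_mul_self_nonneg {K S : Matrix n n ℝ} (hK : K.PosSemidef) (hS : S.IsSymm) :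
    0 ≤ (K * S * S).trace := by
  have := (hK.conjTranspose_mul_mul_same S).trace_nonneg
  rwa [Matrix.conjTranspose_eq_transpose_of_trivial, hS.eq, Matrix.trace_mul_comm,
    ← Matrix.mul_assoc, Matrix.trace_mul_comm, ← Matrix.mul_assoc] at this

/-- Decomposing `K` into rank-one terms `v vᵀ` turns the sum into traces `tr(A T_v T_v)` with `T_v =
∑ₖ vₖ Tₖ` symmetric. -/
lemma sum_mul_trace_nonneg {K : Matrix n n ℝ} (hK : K.PosSemidef) {m : Type} [Fintype m]
    {A : Matrix m m ℝ} (hA : A.PosSemidef) {T : n → Matrix m m ℝ}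
    (hT : ∀ k, (T k).IsSymm) : 0 ≤ ∑ k, ∑ l, K k l * (A * T l * T k).trace := by
  obtain ⟨N, v, rfl⟩ := posSemidef_iff_eq_sum_vecMulVec.1 hK
  have e : ∑ k, ∑ l, (∑ i, vecMulVec (v i) (star (v i))) k l * (A * T l * T k).trace =
      ∑ i, (A * (∑ l, v i l • T l) * (∑ k, v i k • T k)).trace := by
    simp only [Matrix.sum_apply, vecMulVec_apply, star_trivial, Finset.mul_sum,
      Finset.sum_mul, mul_smul_comm, smul_mul_assoc, Matrix.trace_sum, Matrix.trace_smul,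
      smul_eq_mul]
    rw [Finset.sum_comm]
    simp_rw [Finset.sum_comm (t := (Finset.univ : Finset (Fin N)))]
    refine Finset.sum_congr rfl fun i _ => ?_
    rw [Finset.sum_comm]
    refine Finset.sum_congr rfl fun k _ => Finset.sum_congr rfl fun l _ => ?_
    ring
  rw [e]
  refine Finset.sum_nonneg fun i _ => trace_mul_mul_self_nonneg hA ?_
  simp [Matrix.IsSymm, Matrix.transpose_sum, (hT _).eq]

lemma trace_sq_nonneg {K S : Matrix n n ℝ} (hK : K.IsSymm) (hS : S.IsSymm) :
    0 ≤ (S * S * K * K).trace := by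
  have := trace_transpose_mul_self_nonneg (S * K)
  rwa [Matrix.transpose_mul, hK.eq, hS.eq, Matrix.mul_assoc, Matrix.trace_mul_comm,
    ← Matrix.mul_assoc S S] at this

/-- The expression is half the squared Frobenius norm of `KS + SK`; the second trace alone has no
sign. -/
lemma trace_sq_add_nonneg {K S : Matrix n n ℝ} (hK : K.IsSymm) (hS : S.IsSymm) :
    0 ≤ (S * S * K * K).trace + (K * S * K * S).trace := by
  have := trace_transpose_mul_self_nonneg (K * S + S * K)
  rw [Matrix.transpose_add, Matrix.transpose_mul, Matrix.transpose_mul, hK.eq, hS.eq] at this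
  have e1 : (S * K * (K * S)).trace = (S * S * K * K).trace := by
    rw [Matrix.trace_mul_comm (S * S * K), ← Matrix.mul_assoc, Matrix.trace_mul_comm]
    simp only [Matrix.mul_assoc]
    rw [Matrix.trace_mul_comm K]
    simp only [Matrix.mul_assoc]
  have e2 : (K * S * (S * K)).trace = (S * S * K * K).trace := by
    simp only [Matrix.mul_assoc]
    rw [Matrix.trace_mul_comm K]
    simp only [Matrix.mul_assoc]
  have e3 : (S * K * (S * K)).trace = (K * S * K * S).trace := by
    simp only [Matrix.mul_assoc]
    rw [Matrix.trace_mul_comm S]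
    simp only [Matrix.mul_assoc]
  have e4 : (K * S * (K * S)).trace = (K * S * K * S).trace := by
    simp only [Matrix.mul_assoc]
  simp only [Matrix.add_mul, Matrix.mul_add, Matrix.trace_add] at this
  linarith

end Positivity

lemma hasDerivAt_comp_line {f : E d → ℝ} (hf : ContDiff ℝ ∞ f) (x v : E d) (t : ℝ) :
    HasDerivAt (fun t : ℝ => f (x + t • v)) (∑ i, v i * D i f (x + t • v)) t := by
  have h1 : HasDerivAt (fun t : ℝ => x + t • v) v t := by
    simpa using ((hasDerivAt_id t).smul_const v).const_add x
  have h2 := (hf.differentiable (by simp) (x + t • v)).hasFDerivAt.comp_hasDerivAt t h1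
  refine h2.congr_deriv ?_
  have e : v = ∑ i, v i • EuclideanSpace.single i (1 : ℝ) := by
    ext j
    simp [Finset.sum_apply, Pi.single_apply]
  simp only [D]
  generalize fderiv ℝ f (x + t • v) = A
  conv_lhs => rw [e, map_sum]
  simp

/-- On each line through `x` the restriction of `U` is concave, so its derivative is antitone and
its second derivative nonpositive. -/
lemma posSemidef_negHess {U : E d → ℝ} (hU : ContDiff ℝ ∞ U) (hconc : ConcaveOn ℝ Set.univ U)
    (x : E d) : (negHess U x).PosSemidef := by
  refine Matrix.PosSemidef.of_dotProduct_mulVec_nonneg ?_ fun v => ?_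
  · have := isSymm_negHess hU x
    rwa [Matrix.IsHermitian, Matrix.conjTranspose_eq_transpose_of_trivial]
  · set w : E d := WithLp.toLp 2 v with hw
    have hc : ConcaveOn ℝ Set.univ fun t : ℝ => U (x + t • w) := by
      have := hconc.comp_affineMap (AffineMap.lineMap x (x + w) : ℝ →ᵃ[ℝ] E d)
      simpa [Function.comp_def, AffineMap.lineMap_apply, add_comm] using this
    have h1 := hasDerivAt_comp_line hU x w
    have hanti : Antitone fun t : ℝ => ∑ i, w i * D i U (x + t • w) := by
      have := hc.antitoneOn_deriv fun t _ => (h1 t).differentiableAt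
      rw [antitoneOn_univ] at this
      rwa [funext fun t => (h1 t).deriv] at this
    have h2 : HasDerivAt (fun t : ℝ => ∑ i, w i * D i U (x + t • w))
        (∑ i, w i * ∑ j, w j * D j (D i U) (x + (0 : ℝ) • w)) 0 :=
      HasDerivAt.fun_sum fun i _ =>
        (hasDerivAt_comp_line (contDiff_D hU i) x w 0).const_mul (w i)
    have h3 := h2.nonpos_of_antitone hanti
    rw [zero_smul, add_zero] at h3
    have e : star v ⬝ᵥ (negHess U x).mulVec v = -∑ i, w i * ∑ j, w j * D j (D i U) x := by
      simp only [dotProduct, Matrix.mulVec, negHess, Matrix.of_apply, hw, Pi.star_apply,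
        star_trivial, ← Finset.sum_neg_distrib]
      refine Finset.sum_congr rfl fun i _ => ?_
      rw [← mul_neg, ← Finset.sum_neg_distrib]
      congr 1
      refine Finset.sum_congr rfl fun j _ => ?_
      rw [D_comm hU i j]
      ring
    rw [e]
    linarith

/-! ### The integral inequalities behind `S₂`, `T₄` and `T₆` -/

section Inequalities

variable {μ : Measure (E d)} [IsProbabilityMeasure μ] {U : E d → ℝ}

/-- The sum `∑ₖ (∂ₖ K)²`. -/
noncomputable def gradSq (U : E d → ℝ) (x : E d) : Matrix (Fin d) (Fin d) ℝ :=
  ∑ k, dM k (negHess U) x * dM k (negHess U) x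

lemma diffMat_gradSq (hU : ContDiff ℝ ∞ U) : DiffMat U (gradSq U) :=
  DiffMat.sum _ fun k _ => ((DiffMat.negHess U).dM hU k).mul ((DiffMat.negHess U).dM hU k)

/-- The two terms of `∂ₖ(K²)` have the same trace against `∂ₖK`, whence the factor `2`. -/
lemma integral_trace_sq_LM (h : Regular μ U) :
    ∫ x, (negHess U x * negHess U x * LM U (negHess U) x).trace ∂μ =
      -∫ x, 2 * (negHess U x * gradSq U x).trace ∂μ := by
  have hU := h.smooth
  have hK := DiffMat.negHess U
  rw [integral_trace_mul_LM h (hK.mul hK) hK]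
  congr 2
  funext x
  rw [gradSq, Finset.mul_sum, Matrix.trace_sum, Finset.mul_sum]
  refine Finset.sum_congr rfl fun k _ => ?_
  rw [dM_mul hU hK hK]
  simp only [add_mul, Matrix.trace_add, Matrix.mul_assoc]
  rw [Matrix.trace_mul_comm (dM k (negHess U) x)]
  simp only [Matrix.mul_assoc]
  ring

/-- Of the three terms of `∂ₖ(K³)`, the outer two agree under the trace; the middle one is the term
`tr(K T_k K T_k)` of indefinite sign. -/
lemma integral_trace_cube_LM (h : Regular μ U) :
    ∫ x, (negHess U x * negHess U x * negHess U x * LM U (negHess U) x).trace ∂μ =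
      -∫ x, (2 * (gradSq U x * negHess U x * negHess U x).trace +
        ∑ k, (negHess U x * dM k (negHess U) x * negHess U x * dM k (negHess U) x).trace) ∂μ := by
  have hU := h.smooth
  have hK := DiffMat.negHess U
  rw [integral_trace_mul_LM h ((hK.mul hK).mul hK) hK]
  congr 2
  funext x
  rw [gradSq, Finset.sum_mul, Finset.sum_mul, Matrix.trace_sum, Finset.mul_sum,
    ← Finset.sum_add_distrib]
  refine Finset.sum_congr rfl fun k _ => ?_
  rw [dM_mul hU (hK.mul hK) hK, dM_mul hU hK hK]
  simp only [add_mul, Matrix.trace_add, Matrix.mul_assoc]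
  generalize dM k (negHess U) x = T
  generalize negHess U x = K
  have e1 : (T * (K * (K * T))).trace = (T * (T * (K * K))).trace := by
    rw [← Matrix.mul_assoc, ← Matrix.mul_assoc, Matrix.trace_mul_comm, Matrix.mul_assoc]
  have e2 : (K * (K * (T * T))).trace = (T * (T * (K * K))).trace := by
    rw [← Matrix.mul_assoc, Matrix.trace_mul_comm, Matrix.mul_assoc]
  linarith

/-- The mixed term `∑ₖₗ tr (∂ₗ∂ₖK ∂ₖK ∂ₗK)`. -/
noncomputable def mixedTerm (U : E d → ℝ) (x : E d) : ℝ :=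
  ∑ k, ∑ l, (dM l (dM k (negHess U)) x * dM k (negHess U) x * dM l (negHess U) x).trace

lemma diffPoly_mixedTerm (hU : ContDiff ℝ ∞ U) : DiffPoly U (mixedTerm U) :=
  DiffPoly.sum _ fun k _ => DiffPoly.sum _ fun l _ =>
    (((((DiffMat.negHess U).dM hU k).dM hU l).mul ((DiffMat.negHess U).dM hU k)).mul
      ((DiffMat.negHess U).dM hU l)).trace

lemma mixedTerm_eq (hU : ContDiff ℝ ∞ U) (x : E d) : mixedTerm U x =
    ∑ k, ∑ l, (dM l (dM k (negHess U)) x * dM l (negHess U) x * dM k (negHess U) x).trace := by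
  rw [mixedTerm, Finset.sum_comm]
  refine Finset.sum_congr rfl fun k _ => Finset.sum_congr rfl fun l _ => ?_
  rw [dM_comm hU (DiffMat.negHess U) k l]

/-- The two terms of `∂ₗ(T_k²)` give the two orderings of the mixed term, which agree after
exchanging `k` and `l`. -/
lemma integral_trace_gradSq_LM (h : Regular μ U) :
    ∫ x, (gradSq U x * LM U (negHess U) x).trace ∂μ = -∫ x, 2 * mixedTerm U x ∂μ := by
  have hU := h.smooth
  have hK := DiffMat.negHess U
  rw [integral_trace_mul_LM h (diffMat_gradSq hU) hK]
  congr 2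
  funext x
  rw [two_mul]
  nth_rw 2 [mixedTerm_eq hU]
  rw [mixedTerm, Finset.sum_comm, Finset.sum_comm (s := Finset.univ) (t := Finset.univ)
    (f := fun k l => (dM l (dM k (negHess U)) x * dM l (negHess U) x *
      dM k (negHess U) x).trace), ← Finset.sum_add_distrib]
  refine Finset.sum_congr rfl fun l _ => ?_
  have e : dM l (gradSq U) x = ∑ k, (dM l (dM k (negHess U)) x * dM k (negHess U) x +
      dM k (negHess U) x * dM l (dM k (negHess U)) x) := by
    refine (congrFun (dM_sum hU _ (fun k _ => (hK.dM hU k).mul (hK.dM hU k)) l) x).trans ?_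
    simp_rw [dM_mul hU (hK.dM hU _) (hK.dM hU _)]
  rw [e, Finset.sum_mul, Matrix.trace_sum, ← Finset.sum_add_distrib]
  refine Finset.sum_congr rfl fun k _ => ?_
  rw [add_mul, Matrix.trace_add, Matrix.mul_assoc (dM k (negHess U) x),
    Matrix.trace_mul_comm (dM k (negHess U) x)]

/-- The nonnegative remainder of the integration by parts for `tr (K (LK)²)`. -/
noncomputable def remTerm (U : E d → ℝ) (x : E d) : ℝ :=
  ∑ k, ∑ l, ((negHess U x * dM l (dM k (negHess U)) x * dM l (dM k (negHess U)) x).trace +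
    negHess U x k l * (negHess U x * dM l (negHess U) x * dM k (negHess U) x).trace)

lemma diffPoly_remTerm (hU : ContDiff ℝ ∞ U) : DiffPoly U (remTerm U) := by
  have hK := DiffMat.negHess U
  exact DiffPoly.sum _ fun k _ => DiffPoly.sum _ fun l _ =>
    (((hK.mul ((hK.dM hU k).dM hU l)).mul ((hK.dM hU k).dM hU l)).trace).add
      ((hK k l).mul ((hK.mul (hK.dM hU l)).mul (hK.dM hU k)).trace)

lemma remTerm_nonneg (hU : ContDiff ℝ ∞ U) (hconc : ConcaveOn ℝ Set.univ U) (x : E d) :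
    0 ≤ remTerm U x := by
  have hP := posSemidef_negHess hU hconc x
  simp only [remTerm, Finset.sum_add_distrib]
  refine add_nonneg (Finset.sum_nonneg fun k _ => Finset.sum_nonneg fun l _ =>
    trace_mul_mul_self_nonneg hP (isSymm_dM (isSymm_dM (isSymm_negHess hU) k) l x))
    (sum_mul_trace_nonneg hP hP fun k => isSymm_dM (isSymm_negHess hU) k x)

/-- One factor `LK` is integrated by parts. Differentiating the other gives `L T_k` and, through the
commutator, the `K_kl` part of the remainder. The term `tr(SX)` contributes two mixed terms, and a
second integration by parts against `L T_k` contributes the third together with `tr(K(∂ₗT_k)²)`. -/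
lemma integral_trace_mul_LM_LM (h : Regular μ U) :
    ∫ x, (negHess U x * LM U (negHess U) x * LM U (negHess U) x).trace ∂μ =
      ∫ x, (3 * mixedTerm U x + remTerm U x) ∂μ := by
  have hU := h.smooth
  have hK := DiffMat.negHess U
  have hL := hK.LM hU
  have hY := (diffPoly_mixedTerm hU).integrable h
  have hR := (diffPoly_remTerm hU).integrable h
  have iS : Integrable (fun x => (gradSq U x * LM U (negHess U) x).trace) μ :=
    (((diffMat_gradSq hU).mul hL).trace).integrable h
  have dT : ∀ k, DiffMat U fun x => dM k (negHess U) x * negHess U x := fun k =>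
    (hK.dM hU k).mul hK
  have i1 : ∀ k, Integrable (fun x =>
      (dM k (negHess U) x * negHess U x * LM U (dM k (negHess U)) x).trace) μ := fun k =>
    (((dT k).mul ((hK.dM hU k).LM hU)).trace).integrable h
  have i2 : Integrable (fun x => ∑ k, ∑ l, negHess U x k l *
      (negHess U x * dM l (negHess U) x * dM k (negHess U) x).trace) μ :=
    (DiffPoly.sum _ fun k _ => DiffPoly.sum _ fun l _ =>
      (hK k l).mul ((hK.mul (hK.dM hU l)).mul (hK.dM hU k)).trace).integrable h
  have e1 : ∀ x, ∑ k, (dM k (fun x => negHess U x * LM U (negHess U) x) x *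
      dM k (negHess U) x).trace = (gradSq U x * LM U (negHess U) x).trace +
      ∑ k, (dM k (negHess U) x * negHess U x * LM U (dM k (negHess U)) x).trace -
      ∑ k, ∑ l, negHess U x k l *
        (negHess U x * dM l (negHess U) x * dM k (negHess U) x).trace := by
    intro x
    rw [gradSq, Finset.sum_mul, Matrix.trace_sum, ← Finset.sum_add_distrib,
      ← Finset.sum_sub_distrib]
    refine Finset.sum_congr rfl fun k _ => ?_
    simp only [dM_mul hU hK hL, dM_LM hU hK]
    simp only [add_mul, mul_sub, sub_mul, Finset.mul_sum, Finset.sum_mul, Matrix.trace_add,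
      Matrix.trace_sub, Matrix.trace_sum, mul_smul_comm, smul_mul_assoc, Matrix.trace_smul,
      smul_eq_mul]
    have a1 := Matrix.trace_mul_cycle (dM k (negHess U) x) (LM U (negHess U) x)
      (dM k (negHess U) x)
    have a2 := Matrix.trace_mul_cycle (negHess U x) (LM U (dM k (negHess U)) x)
      (dM k (negHess U) x)
    rw [a1, a2]
    ring
  have e2 : ∀ k, ∫ x, (dM k (negHess U) x * negHess U x * LM U (dM k (negHess U)) x).trace ∂μ =
      -∫ x, ∑ l, ((dM l (dM k (negHess U)) x * dM k (negHess U) x * dM l (negHess U) x).trace +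
        (negHess U x * dM l (dM k (negHess U)) x * dM l (dM k (negHess U)) x).trace) ∂μ := by
    intro k
    rw [integral_trace_mul_LM h (dT k) (hK.dM hU k)]
    congr 2
    funext x
    refine Finset.sum_congr rfl fun l _ => ?_
    rw [dM_mul hU (hK.dM hU k) hK, add_mul, Matrix.trace_add, add_comm]
    congr 1
    · rw [Matrix.trace_mul_cycle]
    · rw [Matrix.trace_mul_cycle, Matrix.trace_mul_cycle]
  have hP : DiffPoly U fun x => ∑ k, ∑ l,
      (negHess U x * dM l (dM k (negHess U)) x * dM l (dM k (negHess U)) x).trace :=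
    DiffPoly.sum _ fun k _ => DiffPoly.sum _ fun l _ =>
      ((hK.mul ((hK.dM hU k).dM hU l)).mul ((hK.dM hU k).dM hU l)).trace
  have e3 : ∑ k, ∫ x,
      (dM k (negHess U) x * negHess U x * LM U (dM k (negHess U)) x).trace ∂μ =
      -(∫ x, mixedTerm U x ∂μ + ∫ x, ∑ k, ∑ l,
        (negHess U x * dM l (dM k (negHess U)) x * dM l (dM k (negHess U)) x).trace ∂μ) := by
    rw [Finset.sum_congr rfl fun k _ => e2 k, Finset.sum_neg_distrib, ← integral_finsetSum,
      ← integral_add hY (hP.integrable h)]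
    · simp only [mixedTerm, Finset.sum_add_distrib]
    · exact fun k _ => (DiffPoly.sum _ fun l _ =>
        (((((hK.dM hU k).dM hU l).mul (hK.dM hU k)).mul (hK.dM hU l)).trace).add
          ((hK.mul ((hK.dM hU k).dM hU l)).mul ((hK.dM hU k).dM hU l)).trace).integrable h
  rw [integral_trace_mul_LM h (hK.mul hL) hK]
  simp_rw [e1]
  have i3 : Integrable (fun x => (gradSq U x * LM U (negHess U) x).trace +
      ∑ k, (dM k (negHess U) x * negHess U x * LM U (dM k (negHess U)) x).trace) μ :=
    iS.add (integrable_finsetSum _ fun k _ => i1 k)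
  rw [integral_sub i3 i2,
    integral_add iS (integrable_finsetSum _ fun k _ => i1 k), integral_trace_gradSq_LM h,
    integral_finsetSum _ fun k _ => i1 k, e3, integral_add (hY.const_mul 3) hR,
    integral_const_mul, integral_const_mul]
  simp only [remTerm, Finset.sum_add_distrib]
  rw [integral_add (hP.integrable h) i2]
  ring

/-- The matrix field `LK - K²`. -/
noncomputable def branchMat (U : E d → ℝ) (x : E d) : Matrix (Fin d) (Fin d) ℝ :=
  LM U (negHess U) x - negHess U x * negHess U x

lemma diffMat_branchMat (hU : ContDiff ℝ ∞ U) : DiffMat U (branchMat U) :=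
  ((DiffMat.negHess U).LM hU).sub ((DiffMat.negHess U).mul (DiffMat.negHess U))

lemma isSymm_branchMat (hU : ContDiff ℝ ∞ U) (x : E d) : (branchMat U x).IsSymm := by
  have hs := isSymm_negHess hU
  rw [branchMat, Matrix.IsSymm, Matrix.transpose_sub, Matrix.transpose_mul, (hs x).eq,
    (isSymm_LM hs x).eq]

lemma integral_trace_sq_branchMat_nonpos (h : Regular μ U) (hconc : ConcaveOn ℝ Set.univ U) :
    ∫ x, (negHess U x * negHess U x * branchMat U x).trace ∂μ ≤ 0 := by
  have hU := h.smooth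
  have hK := DiffMat.negHess U
  have hs := isSymm_negHess hU
  have i1 := (((hK.mul hK).mul (hK.LM hU)).trace).integrable h
  have i2 := (((hK.mul hK).mul (hK.mul hK)).trace).integrable h
  simp only [branchMat, mul_sub, Matrix.trace_sub]
  rw [integral_sub i1 i2, integral_trace_sq_LM h]
  have h1 : 0 ≤ ∫ x, 2 * (negHess U x * gradSq U x).trace ∂μ := integral_nonneg fun x => by
    simp only [gradSq, Finset.mul_sum, Matrix.trace_sum, ← Matrix.mul_assoc]
    exact Finset.sum_nonneg fun k _ => mul_nonneg zero_le_two
      (trace_mul_mul_self_nonneg (posSemidef_negHess hU hconc x) (isSymm_dM hs k x))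
  have h2 : 0 ≤ ∫ x, (negHess U x * negHess U x * (negHess U x * negHess U x)).trace ∂μ :=
    integral_nonneg fun x => trace_mul_self_nonneg (by
      rw [Matrix.IsSymm, Matrix.transpose_mul, (hs x).eq])
  linarith

lemma trace_pow_five_nonneg (hU : ContDiff ℝ ∞ U) (hconc : ConcaveOn ℝ Set.univ U) (x : E d) :
    0 ≤ (negHess U x * negHess U x * negHess U x * (negHess U x * negHess U x)).trace := by
  have := trace_mul_mul_self_nonneg (posSemidef_negHess hU hconc x)
    (S := negHess U x * negHess U x) (by
      rw [Matrix.IsSymm, Matrix.transpose_mul, (isSymm_negHess hU x).eq])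
  simpa only [Matrix.mul_assoc] using this

/-- The part with coefficient `1` completes to `½‖K T_k + T_k K‖²`; the excess `c - 1` multiplies
the square `‖T_k K‖²`. -/
lemma two_mul_trace_add_nonneg (hU : ContDiff ℝ ∞ U) (c : ℝ) (hc : 1 ≤ c) (x : E d) :
    0 ≤ c * (gradSq U x * negHess U x * negHess U x).trace +
      ∑ k, (negHess U x * dM k (negHess U) x * negHess U x * dM k (negHess U) x).trace := by
  have hs := isSymm_negHess hU
  rw [gradSq, Finset.sum_mul, Finset.sum_mul, Matrix.trace_sum, Finset.mul_sum,
    ← Finset.sum_add_distrib]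
  refine Finset.sum_nonneg fun k _ => ?_
  have h1 := trace_sq_nonneg (hs x) (isSymm_dM hs k x)
  have h2 := trace_sq_add_nonneg (hs x) (isSymm_dM hs k x)
  nlinarith

omit [IsProbabilityMeasure μ] in
lemma integral_two_mul_trace_add_nonneg (h : Regular μ U) (c : ℝ) (hc : 1 ≤ c) :
    0 ≤ ∫ x, (c * (gradSq U x * negHess U x * negHess U x).trace +
      ∑ k, (negHess U x * dM k (negHess U) x * negHess U x * dM k (negHess U) x).trace) ∂μ :=
  integral_nonneg fun x => two_mul_trace_add_nonneg h.smooth c hc x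

lemma integral_trace_cube_branchMat_nonpos (h : Regular μ U)
    (hconc : ConcaveOn ℝ Set.univ U) :
    ∫ x, (negHess U x * negHess U x * negHess U x * branchMat U x).trace ∂μ ≤ 0 := by
  have hU := h.smooth
  have hK := DiffMat.negHess U
  have i1 := ((((hK.mul hK).mul hK).mul (hK.LM hU)).trace).integrable h
  have i2 := ((((hK.mul hK).mul hK).mul (hK.mul hK)).trace).integrable h
  simp only [branchMat, mul_sub, Matrix.trace_sub]
  rw [integral_sub i1 i2, integral_trace_cube_LM h]
  have h1 := integral_two_mul_trace_add_nonneg h 2 one_le_two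
  have h2 := integral_nonneg (μ := μ) (f := fun x => (negHess U x * negHess U x * negHess U x *
    (negHess U x * negHess U x)).trace) fun x => trace_pow_five_nonneg hU hconc x
  linarith

/-- Pointwise expansion of the `T₆` integrand once `L` sits on `K²`: `2 tr(KX²) + 2 tr(SX) - 3
tr(K³X) - 2 tr(SK²) + tr K⁵`. -/
lemma trace_LM_sq_mul_branchMat (hU : ContDiff ℝ ∞ U) (x : E d) :
    (LM U (fun x => negHess U x * negHess U x) x * branchMat U x).trace -
      (negHess U x * negHess U x * (negHess U x * branchMat U x)).trace =
    2 * (negHess U x * LM U (negHess U) x * LM U (negHess U) x).trace +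
      2 * (gradSq U x * LM U (negHess U) x).trace -
      3 * (negHess U x * negHess U x * negHess U x * LM U (negHess U) x).trace -
      2 * (gradSq U x * negHess U x * negHess U x).trace +
      (negHess U x * negHess U x * negHess U x * (negHess U x * negHess U x)).trace := by
  have hK := DiffMat.negHess U
  rw [LM_mul hU hK hK, ← gradSq, branchMat]
  generalize LM U (negHess U) x = X
  generalize gradSq U x = S
  generalize negHess U x = K
  simp only [add_mul, mul_sub, Matrix.trace_add, Matrix.trace_sub, Matrix.mul_assoc,
    smul_mul_assoc, Matrix.trace_smul, smul_eq_mul]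
  have e1 : (X * (K * X)).trace = (K * (X * X)).trace := by
    rw [Matrix.trace_mul_comm, Matrix.mul_assoc]
  have e2 : (X * (K * (K * K))).trace = (K * (K * (K * X))).trace := by
    rw [Matrix.trace_mul_comm]; simp only [Matrix.mul_assoc]
  have e3 : (K * (X * (K * K))).trace = (K * (K * (K * X))).trace := by
    rw [← Matrix.mul_assoc, Matrix.trace_mul_comm]; simp only [Matrix.mul_assoc]
  linarith

lemma integral_trace_sq_generator_branchMat_nonpos (h : Regular μ U)
    (hconc : ConcaveOn ℝ Set.univ U) :
    ∫ x, (negHess U x * negHess U x *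
      (negHess U x * branchMat U x - LM U (branchMat U) x)).trace ∂μ ≤ 0 := by
  have hU := h.smooth
  have hK := DiffMat.negHess U
  have hM := diffMat_branchMat hU
  have hs := isSymm_negHess hU
  have i1 := (((hK.mul hK).mul (hK.mul hM)).trace).integrable h
  have i2 := (((hK.mul hK).mul (hM.LM hU)).trace).integrable h
  have i3 := ((((hK.mul hK).LM hU).mul hM).trace).integrable h
  have P1 := ((hK.mul (hK.LM hU)).mul (hK.LM hU)).trace
  have P2 := ((diffMat_gradSq hU).mul (hK.LM hU)).trace
  have P3 := (((hK.mul hK).mul hK).mul (hK.LM hU)).trace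
  have P4 := (((diffMat_gradSq hU).mul hK).mul hK).trace
  have j1 := P1.integrable h
  have j2 := P2.integrable h
  have j3 := P3.integrable h
  have j4 := P4.integrable h
  have j5 := ((((hK.mul hK).mul hK).mul (hK.mul hK)).trace).integrable h
  have j6 := (DiffPoly.sum Finset.univ fun k _ =>
    (((hK.mul (hK.dM hU k)).mul hK).mul (hK.dM hU k)).trace).integrable h
  have jY := (diffPoly_mixedTerm hU).integrable h
  have jR := (diffPoly_remTerm hU).integrable h
  have e1 := integral_trace_mul_LM_LM h
  rw [integral_add (jY.const_mul 3) jR, integral_const_mul] at e1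
  have e2 := integral_trace_gradSq_LM h
  rw [integral_const_mul] at e2
  have e3 := integral_trace_cube_LM h
  rw [integral_add (j4.const_mul 2) j6, integral_const_mul] at e3
  have e4 : ∫ x, ((LM U (fun x => negHess U x * negHess U x) x * branchMat U x).trace -
      (negHess U x * negHess U x * (negHess U x * branchMat U x)).trace) ∂μ = _ :=
    integral_congr_ae (Filter.Eventually.of_forall fun x => trace_LM_sq_mul_branchMat hU x)
  have Q1 := (P1.const_mul 2).add (P2.const_mul 2)
  have Q2 := Q1.sub (P3.const_mul 3)
  have k1 := Q1.integrable h
  have k2 := Q2.integrable h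
  have k3 := (Q2.sub (P4.const_mul 2)).integrable h
  rw [integral_sub i3 i1, integral_add k3 j5, integral_sub k2 (j4.const_mul 2),
    integral_sub k1 (j3.const_mul 3), integral_add (j1.const_mul 2) (j2.const_mul 2),
    integral_const_mul, integral_const_mul, integral_const_mul, integral_const_mul] at e4
  simp only [mul_sub, Matrix.trace_sub]
  rw [integral_sub i1 i2, integral_trace_mul_LM_comm h (hK.mul hK) hM]
  have p1 : 0 ≤ ∫ x, (negHess U x * LM U (negHess U) x * LM U (negHess U) x).trace ∂μ :=
    integral_nonneg fun x =>
      trace_mul_mul_self_nonneg (posSemidef_negHess hU hconc x) (isSymm_LM hs x)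
  have p2 := integral_nonneg (μ := μ) (f := remTerm U) fun x => remTerm_nonneg hU hconc x
  have p3 := integral_nonneg (μ := μ) (f := fun x => (negHess U x * negHess U x * negHess U x *
    (negHess U x * negHess U x)).trace) fun x => trace_pow_five_nonneg hU hconc x
  -- Since `-3∫tr(K³X) = 6∫tr(SK²) + 3∫∑ tr(K T_k K T_k)`, subtracting `2∫tr(SK²)` leaves
  -- `3((4/3)∫tr(SK²) + ∫∑ tr(K T_k K T_k))`. The final combination is this, `∫tr K⁵`, and
  -- `(2/3)∫tr(KX²) + (4/3)R` after eliminating the mixed term.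
  have p4 := integral_two_mul_trace_add_nonneg h (4 / 3) (by norm_num)
  rw [integral_add (j4.const_mul _) j6, integral_const_mul] at p4
  linarith

end Inequalities

/-! ### Branch fields of the concrete trees -/

instance decidableRelTreeS : ∀ i, DecidableRel (treeS i).Adj
  | 0 => inferInstanceAs (DecidableRel
      (SimpleGraph.fromEdgeSet {s(0, 1), s(0, 2), s(0, 3), s(0, 4)}).Adj)
  | 1 => inferInstanceAs (DecidableRel
      (SimpleGraph.fromEdgeSet {s(0, 2), s(1, 2), s(2, 3), s(3, 4)}).Adj)
  | 2 => inferInstanceAs (DecidableRel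
      (SimpleGraph.fromEdgeSet {s(0, 1), s(1, 2), s(2, 3), s(3, 4)}).Adj)

instance decidableRelTreeT : ∀ i, DecidableRel (treeT i).Adj
  | 0 => inferInstanceAs (DecidableRel
      (SimpleGraph.fromEdgeSet {s(0, 1), s(0, 2), s(0, 3), s(0, 4), s(0, 5)}).Adj)
  | 1 => inferInstanceAs (DecidableRel
      (SimpleGraph.fromEdgeSet {s(0, 1), s(1, 2), s(2, 3), s(1, 4), s(2, 5)}).Adj)
  | 2 => inferInstanceAs (DecidableRel
      (SimpleGraph.fromEdgeSet {s(0, 1), s(1, 2), s(2, 3), s(3, 4), s(4, 5)}).Adj)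
  | 3 => inferInstanceAs (DecidableRel
      (SimpleGraph.fromEdgeSet {s(0, 1), s(1, 2), s(2, 3), s(1, 4), s(1, 5)}).Adj)
  | 4 => inferInstanceAs (DecidableRel
      (SimpleGraph.fromEdgeSet {s(0, 1), s(1, 2), s(2, 3), s(3, 4), s(2, 5)}).Adj)
  | 5 => inferInstanceAs (DecidableRel
      (SimpleGraph.fromEdgeSet {s(0, 2), s(1, 2), s(2, 3), s(3, 4), s(4, 5)}).Adj)

section Branches

variable {V : Type} [Fintype V] {G : SimpleGraph V} {U : E d → ℝ}
  {m : V → V → E d → E d}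

lemma card_neighborSet [DecidableRel G.Adj] (x : V) [Fintype (G.neighborSet x)] :
    Fintype.card (G.neighborSet x) = (Finset.univ.filter fun y => G.Adj x y).card :=
  Fintype.card_of_subtype _ fun y => by simp

lemma IsBranches.eq_powContr [DecidableRel G.Adj] (hm : IsBranches U G m) {x y : V} {n : ℕ}
    {φ : E d → E d} (hxy : G.Adj x y)
    (hc : (Finset.univ.filter fun z => G.Adj x z).card = n + 1)
    (hz : ∀ z, G.Adj x z → z ≠ y → m z x = φ) : m x y = powContr U n φ := by
  rw [hm.eq_contr x y hxy]
  -- Stated for every `Fintype` instance because the one inside `IsBranches` is classical; likewise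
  -- below.
  have key : ∀ _ : Fintype (G.neighborSet x),
      contr U (fun z : G.neighborSet x => m z x) ⟨y, hxy⟩ = powContr U n φ := fun _ =>
    contr_eq_powContr ((card_neighborSet x).trans hc) _
      (fun k hk => hz _ k.2 fun h => hk (Subtype.ext h)) U
  exact key _

lemma IsBranches.eq_gradU [DecidableRel G.Adj] (hm : IsBranches U G m) {x y : V}
    (hxy : G.Adj x y) (hz : ∀ z, G.Adj x z → z = y) : m x y = gradU U := by
  rw [hm.eq_powContr (n := 0) (φ := gradU U) hxy ?_ fun z h1 h2 => absurd (hz z h1) h2,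
    powContr_zero]
  rw [Finset.card_eq_one]
  refine ⟨y, ?_⟩
  ext z
  simp only [Finset.mem_filter, Finset.mem_univ, true_and, Finset.mem_singleton]
  exact ⟨hz z, fun h => h ▸ hxy⟩

/-- Evaluation rooted at a node whose neighbours, except possibly `y`, all carry the same branch
field. -/
lemma IsBranches.treeVal_eq_trace [DecidableRel G.Adj] {μ : Measure (E d)}
    [IsProbabilityMeasure μ] (hm : IsBranches U G m) (hG : Evaluable G) (h : Regular μ U)
    {x y : V} {n : ℕ} {φ ψ : E d → E d} (hxy : G.Adj x y)
    (hc : (Finset.univ.filter fun z => G.Adj x z).card = n + 1)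
    (hz : ∀ z, G.Adj x z → z ≠ y → m z x = φ) (hy : m y x = ψ) :
    treeVal μ G = (-1) ^ (n + 1) * (n.factorial : ℝ) *
      ∫ p, (gradMatrix φ p ^ n * gradMatrix ψ p).trace ∂μ := by
  rw [hm.treeVal_eq_Lam hG h x, ← integral_const_mul]
  refine integral_congr_ae (Filter.Eventually.of_forall fun p => ?_)
  have key : ∀ _ : Fintype (G.neighborSet x), Lam (fun z : G.neighborSet x => m z x) p =
      (-1) ^ (n + 1) * (n.factorial : ℝ) * (gradMatrix φ p ^ n * gradMatrix ψ p).trace :=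
    fun _ => (Lam_const_off ((card_neighborSet x).trans hc) (⟨y, hxy⟩ : G.neighborSet x)
      (fun k hk => hz _ k.2 fun h => hk (Subtype.ext h)) p).trans (by rw [← hy])
  exact key _

end Branches

section Fields

variable {U : E d → ℝ}

lemma gradMatrix_gradU_eq (hU : ContDiff ℝ ∞ U) :
    gradMatrix (gradU U) = fun x => -negHess U x := funext (gradMatrix_gradU hU)

lemma D_neg (f : E d → ℝ) (i : Fin d) : D i (fun x => -f x) = fun x => -D i f x := by
  funext x
  simp [D, fderiv_fun_neg]

lemma LM_neg (F : E d → Matrix (Fin d) (Fin d) ℝ) (x : E d) :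
    LM U (fun x => -F x) x = -LM U F x := by
  ext i j
  simp only [LM, Lop, W, Matrix.of_apply, Matrix.neg_apply, D_neg, mul_neg,
    ← Finset.sum_neg_distrib, neg_add_rev]
  exact Finset.sum_congr rfl fun k _ => by ring

/-- The field of a branch consisting of two nodes. -/
noncomputable def pathTwo (U : E d → ℝ) : E d → E d := powContr U 1 (gradU U)

/-- The field of a branch consisting of a path with three nodes. -/
noncomputable def pathThree (U : E d → ℝ) : E d → E d := powContr U 1 (pathTwo U)

lemma diffField_pathTwo (hU : ContDiff ℝ ∞ U) : DiffField U (pathTwo U) :=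
  diffField_powContr hU (diffField_gradU U) 1

lemma gradMatrix_pathTwo (hU : ContDiff ℝ ∞ U) : gradMatrix (pathTwo U) = branchMat U := by
  funext x
  rw [pathTwo, gradMatrix_powContr_one hU (diffField_gradU U), gradMatrix_gradU_eq hU, LM_neg,
    branchMat]
  · noncomm_ring
  · intro x
    rw [gradMatrix_gradU hU, Matrix.IsSymm, Matrix.transpose_neg, (isSymm_negHess hU x).eq]

lemma gradMatrix_pathThree (hU : ContDiff ℝ ∞ U) (x : E d) : gradMatrix (pathThree U) x =
    negHess U x * branchMat U x - LM U (branchMat U) x := by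
  rw [pathThree, gradMatrix_powContr_one hU (diffField_pathTwo hU), gradMatrix_pathTwo hU]
  intro x
  rw [gradMatrix_pathTwo hU]
  exact isSymm_branchMat hU x

end Fields

/-! ### Nonnegativity of the values -/

section Nonneg

variable {μ : Measure (E d)} [IsProbabilityMeasure μ] {U : E d → ℝ}

/-- Roots: the centre of the star, the node of degree three, the middle of the path. The integrands
are multiples of `tr K⁴`, `tr(K²M)` and `tr M²`. -/
lemma treeVal_treeS_nonneg (h : Regular μ U) (hconc : ConcaveOn ℝ Set.univ U) (i : Fin 3)
    (hG : Evaluable (treeS i)) : 0 ≤ treeVal μ (treeS i) := by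
  have hU := h.smooth
  obtain ⟨m, hm⟩ := hG.exists_isBranches (d := d) hU
  have hs := isSymm_negHess hU
  match i with
  | 0 =>
    have e : ∀ z, (treeS 0).Adj 0 z → m z 0 = gradU U := fun z hz =>
      hm.eq_gradU hz.symm (by revert z; decide)
    rw [hm.treeVal_eq_trace hG h (x := 0) (y := 1) (n := 3) (by decide) (by decide)
      (fun z hz _ => e z hz) (e 1 (by decide)), gradMatrix_gradU_eq hU]
    refine mul_nonneg (by norm_num [Nat.factorial]) (integral_nonneg fun x => ?_)
    have := trace_mul_self_nonneg (S := negHess U x * negHess U x)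
      (by rw [Matrix.IsSymm, Matrix.transpose_mul, (hs x).eq])
    have e : (-negHess U x) ^ 3 * -negHess U x =
        negHess U x * negHess U x * (negHess U x * negHess U x) := by noncomm_ring
    rwa [← e] at this
  | 1 =>
    have e0 : ∀ z, z ≠ 3 → (treeS 1).Adj 2 z → m z 2 = gradU U := fun z hz hz' =>
      hm.eq_gradU hz'.symm (by revert z; decide)
    have e4 : m 4 3 = gradU U := hm.eq_gradU (by decide) (by decide)
    have e3 : m 3 2 = pathTwo U := hm.eq_powContr (by decide) (by decide) fun z h1 h2 => by
      obtain rfl : z = 4 := by revert z; decide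
      exact e4
    rw [hm.treeVal_eq_trace hG h (x := 2) (y := 3) (n := 2) (by decide) (by decide)
      (fun z hz hz' => e0 z hz' hz) e3, gradMatrix_gradU_eq hU, gradMatrix_pathTwo hU]
    have := integral_trace_sq_branchMat_nonpos h hconc
    simp only [pow_two, neg_mul_neg]
    norm_num [Nat.factorial]
    linarith
  | 2 =>
    have e0 : m 0 1 = gradU U := hm.eq_gradU (by decide) (by decide)
    have e4 : m 4 3 = gradU U := hm.eq_gradU (by decide) (by decide)
    have e1 : m 1 2 = pathTwo U := hm.eq_powContr (by decide) (by decide) fun z h1 h2 => by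
      obtain rfl : z = 0 := by revert z; decide
      exact e0
    have e3 : m 3 2 = pathTwo U := hm.eq_powContr (by decide) (by decide) fun z h1 h2 => by
      obtain rfl : z = 4 := by revert z; decide
      exact e4
    rw [hm.treeVal_eq_trace hG h (x := 2) (y := 3) (n := 1) (by decide) (by decide)
      (fun z h1 h2 => by
        obtain rfl : z = 1 := by revert z; decide
        exact e1) e3, gradMatrix_pathTwo hU]
    refine mul_nonneg (by norm_num [Nat.factorial]) (integral_nonneg fun x => ?_)
    have := trace_mul_self_nonneg (isSymm_branchMat hU x)
    rwa [pow_one]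

/-- `T₂` and `T₃` are cut at their central edge, where the two branch fields coincide. The others
are rooted at the node of largest degree, where at most one branch differs from the rest. For `T₅`
the repeated branch is the two-node path and the odd one the leaf. -/
lemma treeVal_treeT_nonneg (h : Regular μ U) (hconc : ConcaveOn ℝ Set.univ U) (i : Fin 6)
    (hG : Evaluable (treeT i)) : 0 ≤ treeVal μ (treeT i) := by
  have hU := h.smooth
  obtain ⟨m, hm⟩ := hG.exists_isBranches (d := d) hU
  have hs := isSymm_negHess hU
  match i with
  | 0 =>
    have e : ∀ z, (treeT 0).Adj 0 z → m z 0 = gradU U := fun z hz =>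
      hm.eq_gradU hz.symm (by revert z; decide)
    rw [hm.treeVal_eq_trace hG h (x := 0) (y := 1) (n := 4) (by decide) (by decide)
      (fun z hz _ => e z hz) (e 1 (by decide)), gradMatrix_gradU_eq hU,
      show (-1 : ℝ) ^ (4 + 1) * (Nat.factorial 4 : ℝ) = -24 by norm_num [Nat.factorial],
      neg_mul, ← mul_neg, ← integral_neg]
    refine mul_nonneg (by norm_num) (integral_nonneg fun x => ?_)
    have := trace_pow_five_nonneg hU hconc x
    have e : (-negHess U x) ^ 4 * -negHess U x = -(negHess U x * negHess U x * negHess U x *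
        (negHess U x * negHess U x)) := by noncomm_ring
    rwa [← neg_neg (Matrix.trace _), ← Matrix.trace_neg, ← e] at this
  | 1 =>
    have e0 : ∀ x z, (x = 1 ∨ x = 2) → z ≠ 1 → z ≠ 2 → (treeT 1).Adj x z →
        m z x = gradU U := fun x z hx hz hz' ha => hm.eq_gradU ha.symm (by revert x z; decide)
    have e1 : m 1 2 = powContr U 2 (gradU U) :=
      hm.eq_powContr (by decide) (by decide) fun z h1 h2 =>
        e0 1 z (Or.inl rfl) h1.ne' h2 h1
    have e2 : m 2 1 = powContr U 2 (gradU U) :=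
      hm.eq_powContr (by decide) (by decide) fun z h1 h2 =>
        e0 2 z (Or.inr rfl) h2 h1.ne' h1
    rw [hm.treeVal_eq_inner hG h (x := 1) (y := 2) (by decide), e1, e2]
    exact integral_nonneg fun x => real_inner_self_nonneg
  | 2 =>
    have e0 : m 0 1 = gradU U := hm.eq_gradU (by decide) (by decide)
    have e5 : m 5 4 = gradU U := hm.eq_gradU (by decide) (by decide)
    have e1 : m 1 2 = pathTwo U := hm.eq_powContr (by decide) (by decide) fun z h1 h2 => by
      obtain rfl : z = 0 := by revert z; decide
      exact e0
    have e4 : m 4 3 = pathTwo U := hm.eq_powContr (by decide) (by decide) fun z h1 h2 => by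
      obtain rfl : z = 5 := by revert z; decide
      exact e5
    have e2 : m 2 3 = pathThree U := hm.eq_powContr (by decide) (by decide) fun z h1 h2 => by
      obtain rfl : z = 1 := by revert z; decide
      exact e1
    have e3 : m 3 2 = pathThree U := hm.eq_powContr (by decide) (by decide) fun z h1 h2 => by
      obtain rfl : z = 4 := by revert z; decide
      exact e4
    rw [hm.treeVal_eq_inner hG h (x := 2) (y := 3) (by decide), e2, e3]
    exact integral_nonneg fun x => real_inner_self_nonneg
  | 3 =>
    have e0 : ∀ z, z ≠ 2 → (treeT 3).Adj 1 z → m z 1 = gradU U := fun z hz hz' =>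
      hm.eq_gradU hz'.symm (by revert z; decide)
    have e3 : m 3 2 = gradU U := hm.eq_gradU (by decide) (by decide)
    have e2 : m 2 1 = pathTwo U := hm.eq_powContr (by decide) (by decide) fun z h1 h2 => by
      obtain rfl : z = 3 := by revert z; decide
      exact e3
    rw [hm.treeVal_eq_trace hG h (x := 1) (y := 2) (n := 3) (by decide) (by decide)
      (fun z hz hz' => e0 z hz' hz) e2, gradMatrix_gradU_eq hU, gradMatrix_pathTwo hU]
    have := integral_trace_cube_branchMat_nonpos h hconc
    have e : ∀ x, ((-negHess U x) ^ 3 * branchMat U x).trace =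
        -(negHess U x * negHess U x * negHess U x * branchMat U x).trace := by
      intro x
      rw [← Matrix.trace_neg]
      congr 1
      noncomm_ring
    simp_rw [e]
    rw [integral_neg]
    exact mul_nonneg (by norm_num [Nat.factorial]) (by linarith)
  | 4 =>
    have e0 : m 0 1 = gradU U := hm.eq_gradU (by decide) (by decide)
    have e4 : m 4 3 = gradU U := hm.eq_gradU (by decide) (by decide)
    have e5 : m 5 2 = gradU U := hm.eq_gradU (by decide) (by decide)
    have e1 : m 1 2 = pathTwo U := hm.eq_powContr (by decide) (by decide) fun z h1 h2 => by
      obtain rfl : z = 0 := by revert z; decide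
      exact e0
    have e3 : m 3 2 = pathTwo U := hm.eq_powContr (by decide) (by decide) fun z h1 h2 => by
      obtain rfl : z = 4 := by revert z; decide
      exact e4
    rw [hm.treeVal_eq_trace hG h (x := 2) (y := 5) (n := 2) (φ := pathTwo U) (by decide)
      (by decide) (fun z h1 h2 => by
        obtain rfl | rfl : z = 1 ∨ z = 3 := by revert z; decide
        · exact e1
        · exact e3) e5, gradMatrix_gradU_eq hU, gradMatrix_pathTwo hU,
      show (-1 : ℝ) ^ (2 + 1) * (Nat.factorial 2 : ℝ) = -2 by norm_num [Nat.factorial],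
      neg_mul, ← mul_neg, ← integral_neg]
    refine mul_nonneg (by norm_num) (integral_nonneg fun x => ?_)
    have := trace_mul_mul_self_nonneg (posSemidef_negHess hU hconc x) (isSymm_branchMat hU x)
    simp only
    rw [mul_neg, Matrix.trace_neg, neg_neg, Matrix.trace_mul_comm, pow_two, ← Matrix.mul_assoc]
    exact this
  | 5 =>
    have e0 : ∀ z, z ≠ 3 → (treeT 5).Adj 2 z → m z 2 = gradU U := fun z hz hz' =>
      hm.eq_gradU hz'.symm (by revert z; decide)
    have e5 : m 5 4 = gradU U := hm.eq_gradU (by decide) (by decide)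
    have e4 : m 4 3 = pathTwo U := hm.eq_powContr (by decide) (by decide) fun z h1 h2 => by
      obtain rfl : z = 5 := by revert z; decide
      exact e5
    have e3 : m 3 2 = pathThree U := hm.eq_powContr (by decide) (by decide) fun z h1 h2 => by
      obtain rfl : z = 4 := by revert z; decide
      exact e4
    rw [hm.treeVal_eq_trace hG h (x := 2) (y := 3) (n := 2) (by decide) (by decide)
      (fun z hz hz' => e0 z hz' hz) e3, gradMatrix_gradU_eq hU]
    simp_rw [gradMatrix_pathThree hU]
    have := integral_trace_sq_generator_branchMat_nonpos h hconc
    simp only [pow_two, neg_mul_neg]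
    norm_num [Nat.factorial]
    linarith

end Nonneg

/-! ### Enumeration of the components of the forests -/

/-- The tree with one node. -/
def treeOne : Fin 1 → SimpleGraph (Fin 1)
  | 0 => SimpleGraph.fromEdgeSet ∅

/-- The tree with two nodes. -/
def treeTwo : Fin 1 → SimpleGraph (Fin 2)
  | 0 => SimpleGraph.fromEdgeSet {s(0, 1)}

/-- The tree with three nodes. -/
def treeThree : Fin 1 → SimpleGraph (Fin 3)
  | 0 => SimpleGraph.fromEdgeSet {s(0, 1), s(1, 2)}

/-- The trees with four nodes: the star and the path. -/
def treeFour : Fin 2 → SimpleGraph (Fin 4)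
  | 0 => SimpleGraph.fromEdgeSet {s(0, 1), s(0, 2), s(0, 3)}
  | 1 => SimpleGraph.fromEdgeSet {s(0, 1), s(1, 2), s(2, 3)}

instance decidableRelTreeOne : ∀ i, DecidableRel (treeOne i).Adj
  | 0 => inferInstanceAs (DecidableRel (SimpleGraph.fromEdgeSet ∅).Adj)

instance decidableRelTreeTwo : ∀ i, DecidableRel (treeTwo i).Adj
  | 0 => inferInstanceAs (DecidableRel (SimpleGraph.fromEdgeSet {s(0, 1)}).Adj)

instance decidableRelTreeThree : ∀ i, DecidableRel (treeThree i).Adj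
  | 0 => inferInstanceAs (DecidableRel (SimpleGraph.fromEdgeSet {s(0, 1), s(1, 2)}).Adj)

instance decidableRelTreeFour : ∀ i, DecidableRel (treeFour i).Adj
  | 0 => inferInstanceAs (DecidableRel
      (SimpleGraph.fromEdgeSet {s(0, 1), s(0, 2), s(0, 3)}).Adj)
  | 1 => inferInstanceAs (DecidableRel
      (SimpleGraph.fromEdgeSet {s(0, 1), s(1, 2), s(2, 3)}).Adj)

/-- The family `R` represents the components of `F^n` up to isomorphism. -/
def Represents (n : ℕ) {κ : Type} (R : κ → SimpleGraph (Fin (n + 1))) : Prop :=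
  (∀ G ∈ forest n, ∃ i, Nonempty (G ≃g R i)) ∧ ∀ i, ∃ G ∈ forest n, Nonempty (G ≃g R i)

/-- The boolean adjacency function of `addLeaf T x`. -/
def addLeafAdj {n : ℕ} (T : SimpleGraph (Fin n)) [DecidableRel T.Adj] (x : Fin n)
    (a b : Fin (n + 1)) : Bool :=
  Fin.lastCases (Fin.lastCases false (fun b => decide (b = x)) b)
    (fun a => Fin.lastCases (decide (a = x)) (fun b => decide (T.Adj a b)) b) a

lemma addLeafAdj_iff {n : ℕ} (T : SimpleGraph (Fin n)) [DecidableRel T.Adj] (x : Fin n)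
    (a b : Fin (n + 1)) : addLeafAdj T x a b = true ↔ (addLeaf T x).Adj a b := by
  refine Fin.lastCases ?_ (fun a => ?_) a <;> refine Fin.lastCases ?_ (fun b => ?_) b
  · simp [addLeafAdj]
  · rw [SimpleGraph.adj_comm, addLeaf_adj_last]
    simp [addLeafAdj]
  · rw [addLeaf_adj_last]
    simp [addLeafAdj]
  · rw [addLeaf_adj_castSucc]
    simp [addLeafAdj]

/-- Leaf extension respects isomorphism, so it suffices to extend representatives. The table `f`
names, for each representative and node, the resulting tree and a vertex bijection; its three
conditions are finite checks, adjacency being expressed by a Boolean function for `decide`. -/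
lemma Represents.succ {n : ℕ} {ι κ : Type} {R : ι → SimpleGraph (Fin (n + 1))}
    [∀ i, DecidableRel (R i).Adj] {R' : κ → SimpleGraph (Fin (n + 2))} (hR : Represents n R)
    (f : ι → Fin (n + 1) → κ × (Fin (n + 2) → Fin (n + 2)))
    (hf : ∀ i x, Function.Injective (f i x).2)
    (hadj : ∀ i x a b, (R' (f i x).1).Adj ((f i x).2 a) ((f i x).2 b) ↔
      addLeafAdj (R i) x a b = true)
    (hsurj : ∀ k, ∃ i x, (f i x).1 = k) : Represents (n + 1) R' := by
  have iso : ∀ i x, Nonempty (addLeaf (R i) x ≃g R' (f i x).1) := fun i x =>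
    ⟨⟨Equiv.ofBijective _ (Finite.injective_iff_bijective.1 (hf i x)), fun {a b} =>
      (hadj i x a b).trans (addLeafAdj_iff (R i) x a b)⟩⟩
  have mem : ∀ G, G ∈ forest (n + 1) ↔ ∃ T ∈ forest n, ∃ x, addLeaf T x = G := by
    simp [forest]
  refine ⟨fun G hG => ?_, fun k => ?_⟩
  · obtain ⟨T, hT, x, rfl⟩ := (mem G).1 hG
    obtain ⟨i, ⟨φ⟩⟩ := hR.1 T hT
    obtain ⟨ψ⟩ := iso i (φ x)
    exact ⟨_, ⟨(addLeafIso φ x).trans ψ⟩⟩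
  · obtain ⟨i, x, rfl⟩ := hsurj k
    obtain ⟨T, hT, ⟨φ⟩⟩ := hR.2 i
    -- The node is written as an image under `φ` because `addLeafIso` adds the leaf at `φ` of a node
    -- of the source.
    obtain ⟨ψ⟩ := iso i (φ (φ.symm x))
    rw [φ.apply_symm_apply] at ψ
    have χ := addLeafIso φ (φ.symm x)
    rw [φ.apply_symm_apply] at χ
    exact ⟨_, (mem _).2 ⟨T, hT, φ.symm x, rfl⟩, ⟨χ.trans ψ⟩⟩

lemma represents_treeOne : Represents 0 treeOne := by
  have : treeOne 0 = ⊥ := SimpleGraph.fromEdgeSet_empty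
  refine ⟨fun G hG => ⟨0, ?_⟩, fun i => ⟨⊥, by simp [forest], ?_⟩⟩
  · obtain rfl : G = ⊥ := by simpa [forest] using hG
    rw [this]
    exact ⟨SimpleGraph.Iso.refl⟩
  · rw [Subsingleton.elim i 0, this]
    exact ⟨SimpleGraph.Iso.refl⟩

/-- Isomorphisms from the leaf extensions of `treeOne` to the trees `treeTwo`. -/
def leafTableOne : Fin 1 → Fin 1 → Fin 1 × (Fin 2 → Fin 2) :=
  ![![(0, ![0, 1])]]

lemma represents_treeTwo : Represents 1 treeTwo :=
  represents_treeOne.succ leafTableOne (by decide) (by decide) (by decide)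

/-- Isomorphisms from the leaf extensions of `treeTwo` to the trees `treeThree`. -/
def leafTableTwo : Fin 1 → Fin 2 → Fin 1 × (Fin 3 → Fin 3) :=
  ![![(0, ![1, 0, 2]),
      (0, ![0, 1, 2])]]

lemma represents_treeThree : Represents 2 treeThree :=
  represents_treeTwo.succ leafTableTwo (by decide) (by decide) (by decide)

/-- Isomorphisms from the leaf extensions of `treeThree` to the trees `treeFour`. -/
def leafTableThree : Fin 1 → Fin 3 → Fin 2 × (Fin 4 → Fin 4) :=
  ![![(1, ![1, 2, 3, 0]),
      (0, ![1, 0, 2, 3]),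
      (1, ![0, 1, 2, 3])]]

lemma represents_treeFour : Represents 3 treeFour :=
  represents_treeThree.succ leafTableThree (by decide) (by decide) (by decide)

/-- Isomorphisms from the leaf extensions of `treeFour` to the trees `treeS`. -/
def leafTableFour : Fin 2 → Fin 4 → Fin 3 × (Fin 5 → Fin 5) :=
  ![![(0, ![0, 1, 2, 3, 4]),
      (1, ![2, 3, 0, 1, 4]),
      (1, ![2, 0, 3, 1, 4]),
      (1, ![2, 0, 1, 3, 4])],
    ![(2, ![1, 2, 3, 4, 0]),
      (1, ![0, 2, 3, 4, 1]),
      (1, ![4, 3, 2, 0, 1]),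
      (2, ![0, 1, 2, 3, 4])]]

lemma represents_treeS : Represents 4 treeS :=
  represents_treeFour.succ leafTableFour (by decide) (by decide) (by decide)

/-- Isomorphisms from the leaf extensions of `treeS` to the trees `treeT`. -/
def leafTableFive : Fin 3 → Fin 5 → Fin 6 × (Fin 6 → Fin 6) :=
  ![![(0, ![0, 1, 2, 3, 4, 5]),
      (3, ![1, 2, 0, 4, 5, 3]),
      (3, ![1, 0, 2, 4, 5, 3]),
      (3, ![1, 0, 4, 2, 5, 3]),
      (3, ![1, 0, 4, 5, 2, 3])],
    ![(4, ![1, 5, 2, 3, 4, 0]),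
      (4, ![5, 1, 2, 3, 4, 0]),
      (3, ![0, 4, 1, 2, 3, 5]),
      (1, ![0, 4, 1, 2, 3, 5]),
      (5, ![0, 1, 2, 3, 4, 5])],
    ![(2, ![1, 2, 3, 4, 5, 0]),
      (5, ![0, 2, 3, 4, 5, 1]),
      (4, ![0, 1, 2, 3, 4, 5]),
      (5, ![5, 4, 3, 2, 0, 1]),
      (2, ![0, 1, 2, 3, 4, 5])]]

lemma represents_treeT : Represents 5 treeT :=
  represents_treeS.succ leafTableFive (by decide) (by decide) (by decide)

/-- Evaluability is inherited from the inductive construction of the forest, so no separate tree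
check is needed for the concrete graphs. -/
lemma Represents.evaluable {n : ℕ} {κ : Type} {R : κ → SimpleGraph (Fin (n + 1))}
    (hR : Represents n R) (i : κ) : Evaluable (R i) := by
  obtain ⟨G, hG, ⟨φ⟩⟩ := hR.2 i
  exact (evaluable_of_mem_forest hG).of_iso φ.symm

lemma Represents.treeVal_nonneg {d n : ℕ} {κ : Type} {R : κ → SimpleGraph (Fin (n + 1))}
    (hR : Represents n R) {μ : Measure (E d)} [IsProbabilityMeasure μ] {U : E d → ℝ}
    (h : Regular μ U) (hpos : ∀ i, 0 ≤ treeVal μ (R i)) :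
    (∀ G ∈ forest n, (∃! c : ℝ, IsTreeVal μ G c) ∧ 0 ≤ treeVal μ G) ∧
      0 ≤ forestVal μ (forest n) := by
  have key : ∀ G ∈ forest n, (∃! c : ℝ, IsTreeVal μ G c) ∧ 0 ≤ treeVal μ G := by
    intro G hG
    have he := evaluable_of_mem_forest hG
    obtain ⟨i, ⟨φ⟩⟩ := hR.1 G hG
    exact ⟨he.existsUnique_isTreeVal h, (hpos i).trans_eq (treeVal_of_iso he h φ).symm⟩
  refine ⟨key, List.sum_nonneg fun c hc => ?_⟩
  obtain ⟨G, hG, rfl⟩ := List.mem_map.1 hc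
  exact (key G hG).2

end GCM

open GCM
theorem mainTheorem2 (d : ℕ) (μ : Measure (E d)) [IsProbabilityMeasure μ]
    (hμ2 : MemLp (fun x : E d => x) 2 μ)
    (U : E d → ℝ) (hU : ContDiff ℝ ∞ U)
    (hdens : μ = volume.withDensity fun x => ENNReal.ofReal (Real.exp (U x)))
    (hconc : ConcaveOn ℝ Set.univ U)
    (hmom : ∀ k : ℕ, 1 ≤ k → ∀ p : ℝ≥0, MemLp (iteratedFDeriv ℝ k U) (p : ℝ≥0∞) μ) :
    (∀ i : Fin 3, (∃! c : ℝ, IsTreeVal μ (treeS i) c) ∧ 0 ≤ treeVal μ (treeS i)) ∧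
    (∀ i : Fin 6, (∃! c : ℝ, IsTreeVal μ (treeT i) c) ∧ 0 ≤ treeVal μ (treeT i)) ∧
    ((∀ G ∈ forest 4, ∃ i, Nonempty (G ≃g treeS i)) ∧
      (∀ i, ∃ G ∈ forest 4, Nonempty (G ≃g treeS i))) ∧
    ((∀ G ∈ forest 5, ∃ i, Nonempty (G ≃g treeT i)) ∧
      (∀ i, ∃ G ∈ forest 5, Nonempty (G ≃g treeT i))) ∧
    ((∀ G ∈ forest 4, (∃! c : ℝ, IsTreeVal μ G c) ∧ 0 ≤ treeVal μ G) ∧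
      0 ≤ forestVal μ (forest 4)) ∧
    ((∀ G ∈ forest 5, (∃! c : ℝ, IsTreeVal μ G c) ∧ 0 ≤ treeVal μ G) ∧
      0 ≤ forestVal μ (forest 5)) := by
  have h : Regular μ U := ⟨hU, hdens, hmom⟩
  have hS := fun i => treeVal_treeS_nonneg h hconc i (represents_treeS.evaluable i)
  have hT := fun i => treeVal_treeT_nonneg h hconc i (represents_treeT.evaluable i)
  exact ⟨fun i => ⟨(represents_treeS.evaluable i).existsUnique_isTreeVal h, hS i⟩,
    fun i => ⟨(represents_treeT.evaluable i).existsUnique_isTreeVal h, hT i⟩,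
    represents_treeS, represents_treeT, represents_treeS.treeVal_nonneg h hS,
    represents_treeT.treeVal_nonneg h hT⟩
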